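/- Let $p\ge q\ge 1$ be integers, $[n]=\{1,\dots,n\}$, $[n]_0=\{0,\dots,n\}$, $q(i)=\min\{i,q\}$ and $I=\{(i,j)\in[p]\times[q] : i\ge j\}$. The packing orbitope $O^{\le}_{p,q}$ (respectively, the partitioning orbitope $O^{=}_{p,q}$) is the convex hull of all $0/1$-matrices of size $p\times q$ whose columns are in lexicographically decreasing (i.e. non-increasing) order and which have at most (respectively, exactly) one $1$-entry per row. Since these matrices vanish above the main diagonal, both polytopes are regarded as subsets of $\mathbb{R}^{I}$. For a vector $u$ and a set $N$ of indices let $u(N)=\sum_{e\in N}u_e$. Let $D$ be the digraph with node set $I\cup([p]_0\times\{0\})\cup\{s,t\}$ whose arcs are the vertical arcs $((i,j),(i+1,j))$ ($i\in[p-1]_0$, $j\in[q(i)]_0$), the diagonal arcs $d_{i,j}=((i,j),(i+1,j+1))$ ($i\in[p-1]_0$, $j\in[q(i+1)-1]_0$), the arc $(s,(0,0))$, and the arcs $((p,j),t)$ ($j\in[q]_0$); let $A$ be its arc set. For $(i,j)\in I$ let $\mathrm{bar}(i,j)=\{(i,\ell)\in I:\ell\ge j\}$, and let $\delta(i,j)$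 be the set of diagonal arcs $d_{k-1,j-1}$ with $j\le k\le i$, i.e. of the diagonal arcs entering the part $\{(k,j):j\le k\le i\}$ of column $j$. Let $P_{p,q}\subseteq\mathbb{R}^{I}\times\mathbb{R}^{A}$ be the set of all $(x,y)$ such that $y\ge 0$ is an $s$-$t$-flow of value one in $D$ and $y_{d_{i-1,j-1}}\le x_{ij}$ and $x(\mathrm{bar}(i,j))\le y(\delta(i,j))$ for all $(i,j)\in I$. Let $Q_{p,q}\subseteq\mathbb{R}^{I}\times\mathbb{R}^{I}$ be the set of all $(z,w)$ that satisfy, with $z_{ij}=w_{ij}=0$ for $(i,j)\notin I$, $$\begin{array}{rll} (1)& w_{i+1,j+1}-w_{i,j+1}\ge 0 & (i\in[p-1]_0,\ j\in[q(i+1)-1]_0),\\ (2)& w_{i,j}-w_{i+1,j+1}\ge 0 & ((i,j)\in I,\ i<p),\\ (3)& w_{p,1}\le 1, &\\ (4)& w_{i,j}-w_{i-1,j}-z_{i,j}+z_{i,j+1}\le 0 & ((i,j)\in I),\\ (5)& z_{i,j}-w_{i,j}\le 0 & ((i,j)\in I),\\ (6)& w_{i,q(i)}\ge 0 & (i\in[p]).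 \end{array}$$ A polytope is the convex hull of a finite set. A polytope $Q$ is an extended formulation of $P$ if $P$ is the image of $Q$ under some linear map. Then the following hold. (a) Consider the linear map $T:(x,y)\mapsto(z,w)$ with $z_{ij}=x(\mathrm{bar}(i,j))$, $w_{ij}=y(\delta(i,j))$ for $(i,j)\in I$. For all $(x,y)\in\mathbb{R}^I\times\mathbb{R}^A$ and $(z,w)\in\mathbb{R}^I\times\mathbb{R}^I$ one has $T(x,y)=(z,w)$ if and only if $x_{ij}=z_{i,j}-z_{i,j+1}$ for all $(i,j)\in I$ and $y_{d_{i,j}}=w_{i+1,j+1}-w_{i,j+1}$ for all $i\in[p-1]_0$, $j\in[q(i+1)-1]_0$. Moreover $T$ maps $P_{p,q}$ bijectively onto $Q_{p,q}$. (b) The system (1)–(6) has at most $2pq$ variables, and fewer than $2pq$ if $q\ge 2$. It has fewer than $4pq$ constraints, not counting those that merely state the nonnegativity of a single variable; if $q\ge 2$, it has fewer than $4pq$ constraints even when only the nonnegativity constraints (6) are not counted. The constraints (1)–(5) have fewer than $10pq$ nonzero coefficients in total. (c) $Q_{p,q}$ is an extended formulation of $O^{\le}_{p,q}$; indeed $O^{\le}_{p,q}$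 is the image of $Q_{p,q}$ under the linear map $(z,w)\mapsto x$ with $x_{ij}=z_{i,j}-z_{i,j+1}$. (d) The inequality $w_{1,1}\le 1$ is valid for $Q_{p,q}$, and the face $\{(z,w)\in Q_{p,q}: w_{1,1}=1\}$ is an extended formulation of $O^{=}_{p,q}$; indeed $O^{=}_{p,q}$ is the image of this face under the linear map $(z,w)\mapsto x$ with $x_{i1}=w_{1,1}-z_{i,2}$ and $x_{ij}=z_{i,j}-z_{i,j+1}$ for $j\ge 2$. -/

import Mathlib

namespace Orbitope

noncomputable section

/-- The index set of pairs `(i,j)` with `1 ≤ i ≤ p`, `1 ≤ j ≤ q` and `i ≥ j`. -/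
def inds (p q : ℕ) : Finset (ℕ × ℕ) :=
  (Finset.Icc 1 p ×ˢ Finset.Icc 1 q).filter fun a => a.2 ≤ a.1

/-- The coordinate with index `a` of a vector indexed by the finite set `S`;
it is `0` when `a ∉ S`. -/
def coord {α : Type} [DecidableEq α] {S : Finset α} (a : α) : (S → ℝ) →ₗ[ℝ] ℝ :=
  if h : a ∈ S then LinearMap.proj (⟨a, h⟩ : S) else 0

/-- The sum `x(N)` of the coordinates of `x` with indices in `N`. -/
def total {α : Type} [DecidableEq α] {S : Finset α} (N : Finset α) : (S → ℝ) →ₗ[ℝ] ℝ :=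
  ∑ a ∈ N, coord a

/-! ### The two orbitopes -/

/-- The `p × q` matrices with entries in `{0,1}` whose columns are in lexicographically
decreasing (i.e. non-increasing) order, the first row being the most significant one. -/
def sortedMatrices (p q : ℕ) : Set (Matrix (Finset.Icc 1 p) (Finset.Icc 1 q) ℝ) :=
  {M | (∀ i j, M i j = 0 ∨ M i j = 1) ∧ Antitone fun j => toLex fun i => M i j}

/-- The entries of a `p × q` matrix at the positions in `inds p q`. A matrix in `sortedMatrices`
with at most one `1` per row vanishes at all the other positions. -/
def onInds (p q : ℕ) (M : Matrix (Finset.Icc 1 p) (Finset.Icc 1 q) ℝ) : inds p q → ℝ :=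
  fun a => M ⟨a.1.1, (Finset.mem_product.1 (Finset.mem_filter.1 a.2).1).1⟩
    ⟨a.1.2, (Finset.mem_product.1 (Finset.mem_filter.1 a.2).1).2⟩

/-- The packing orbitope: at most one `1` per row. -/
def packingOrbitope (p q : ℕ) : Set (inds p q → ℝ) :=
  onInds p q '' convexHull ℝ
    {M ∈ sortedMatrices p q | ∀ i j j', M i j = 1 → M i j' = 1 → j = j'}

/-- The partitioning orbitope: exactly one `1` per row. -/
def partitioningOrbitope (p q : ℕ) : Set (inds p q → ℝ) :=
  onInds p q '' convexHull ℝ {M ∈ sortedMatrices p q | ∀ i, ∃! j, M i j = 1}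

/-! ### The digraph -/

/-- Possible nodes: the source `s`, the sink `t`, and grid points. -/
inductive Node : Type
  | s : Node
  | t : Node
  | grid (i j : ℕ) : Node
  deriving DecidableEq

def nodes (p q : ℕ) : Finset Node :=
  (inds p q).image (fun a => Node.grid a.1 a.2) ∪
    (Finset.range (p + 1)).image (fun i => Node.grid i 0) ∪ {Node.s, Node.t}

/-- The vertical arc from `(i,j)` to `(i+1,j)`. -/
def vArc (i j : ℕ) : Node × Node := (Node.grid i j, Node.grid (i + 1) j)

/-- The diagonal arc from `(i,j)` to `(i+1,j+1)`. -/
def dArc (i j : ℕ) : Node × Node := (Node.grid i j, Node.grid (i + 1) (j + 1))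

def vertArcs (p q : ℕ) : Finset (Node × Node) :=
  ((Finset.range p ×ˢ Finset.range (q + 1)).filter fun a => a.2 ≤ min a.1 q).image
    fun a => vArc a.1 a.2

def diagArcs (p q : ℕ) : Finset (Node × Node) :=
  ((Finset.range p ×ˢ Finset.range q).filter fun a => a.2 < min (a.1 + 1) q).image
    fun a => dArc a.1 a.2

def arcs (p q : ℕ) : Finset (Node × Node) :=
  vertArcs p q ∪ diagArcs p q ∪ {(Node.s, Node.grid 0 0)} ∪
    (Finset.range (q + 1)).image fun j => (Node.grid p j, Node.t)

def outArcs (p q : ℕ) (W : Finset Node) : Finset (Node × Node) :=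
  (arcs p q).filter fun e => e.1 ∈ W ∧ e.2 ∉ W

def inArcs (p q : ℕ) (W : Finset Node) : Finset (Node × Node) :=
  (arcs p q).filter fun e => e.2 ∈ W ∧ e.1 ∉ W

def diagInArcs (p q : ℕ) (W : Finset Node) : Finset (Node × Node) :=
  (diagArcs p q).filter fun e => e.2 ∈ W ∧ e.1 ∉ W

/-- The `s`-`t`-flows of value one. -/
def flows (p q : ℕ) : Set (arcs p q → ℝ) :=
  {y | (∀ e, 0 ≤ y e) ∧
    (∀ v ∈ nodes p q, v ≠ Node.s → v ≠ Node.t →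
      total (inArcs p q {v}) y = total (outArcs p q {v}) y) ∧
    total (outArcs p q {Node.s}) y - total (inArcs p q {Node.s}) y = 1}

/-- The bar of `(i,j)`: the pairs `(i,l)` with `l ≥ j`. -/
def bar (p q i j : ℕ) : Finset (ℕ × ℕ) :=
  (inds p q).filter fun a => a.1 = i ∧ j ≤ a.2

/-- The upper part of column `j`: the nodes `(k,j)` with `j ≤ k ≤ i`. -/
def vbar (p q i j : ℕ) : Finset Node :=
  ((inds p q).filter fun a => a.2 = j ∧ a.1 ≤ i).image fun a => Node.grid a.1 a.2

/-- The polytope in the space of all `(x,y)` with a flow `y` coupled to `x`. -/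
def extPoly (p q : ℕ) : Set ((inds p q → ℝ) × (arcs p q → ℝ)) :=
  {v | v.2 ∈ flows p q ∧
    (∀ i j, (i, j) ∈ inds p q → coord (dArc (i - 1) (j - 1)) v.2 ≤ coord (i, j) v.1) ∧
    (∀ i j, (i, j) ∈ inds p q →
      total (bar p q i j) v.1 ≤ total (diagInArcs p q (vbar p q i j)) v.2)}

/-! ### The change of variables and the compact system -/

/-- The space of all `(z,w)`. -/
abbrev Space (p q : ℕ) : Type := (inds p q → ℝ) × (inds p q → ℝ)

/-- `z i j`, with value `0` when `(i,j)` is not an index. -/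
def zVar (p q i j : ℕ) : Space p q →ₗ[ℝ] ℝ := coord (i, j) ∘ₗ LinearMap.fst ℝ _ _

/-- `w i j`, with value `0` when `(i,j)` is not an index. -/
def wVar (p q i j : ℕ) : Space p q →ₗ[ℝ] ℝ := coord (i, j) ∘ₗ LinearMap.snd ℝ _ _

/-- `(x,y) ↦ (z,w)`, where `z i j` is the sum of `x` over the bar of `(i,j)` and `w i j` is the
sum of `y` over the diagonal arcs that enter the upper part of column `j` down to `(i,j)`. -/
def changeVars (p q : ℕ) :
    ((inds p q → ℝ) × (arcs p q → ℝ)) →ₗ[ℝ] Space p q :=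
  LinearMap.prodMap (LinearMap.pi fun a => total (bar p q a.1.1 a.1.2))
    (LinearMap.pi fun a => total (diagInArcs p q (vbar p q a.1.1 a.1.2)))

/-- Recovering `x` from `(z,w)`: `x i j = z i j - z i (j+1)`. -/
def recoverX (p q : ℕ) : Space p q →ₗ[ℝ] (inds p q → ℝ) :=
  LinearMap.pi fun a => zVar p q a.1.1 a.1.2 - zVar p q a.1.1 (a.1.2 + 1)

/-- The projection of `(z,w)` to the `x`-space with `x i 1 = w 1 1 - z i 2` in the first column
and `x i j = z i j - z i (j+1)` in the other columns. -/
def completeX (p q : ℕ) : Space p q →ₗ[ℝ] (inds p q → ℝ) :=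
  LinearMap.pi fun a =>
    (if a.1.2 = 1 then wVar p q 1 1 else zVar p q a.1.1 a.1.2) - zVar p q a.1.1 (a.1.2 + 1)

/-- The individual constraints of the compact system (families of constraints, with their
index ranges). -/
inductive Constraint (p q : ℕ) : Type
  | diag (i j : ℕ) (hi : i < p) (hj : j < min (i + 1) q) : Constraint p q
  | vert (i j : ℕ) (h : (i, j) ∈ inds p q) (hi : i < p) : Constraint p q
  | top : Constraint p q
  | lower (i j : ℕ) (h : (i, j) ∈ inds p q) : Constraint p q
  | upper (i j : ℕ) (h : (i, j) ∈ inds p q) : Constraint p q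
  | nonneg (i : ℕ) (hi : 1 ≤ i) (hip : i ≤ p) : Constraint p q

/-- The left-hand side of a constraint, written in the form `lhs ≤ rhs`. -/
def Constraint.lhs {p q : ℕ} : Constraint p q → (Space p q →ₗ[ℝ] ℝ)
  | .diag i j _ _ => wVar p q i (j + 1) - wVar p q (i + 1) (j + 1)
  | .vert i j _ _ => wVar p q (i + 1) (j + 1) - wVar p q i j
  | .top => wVar p q p 1
  | .lower i j _ => wVar p q i j - wVar p q (i - 1) j - zVar p q i j + zVar p q i (j + 1)
  | .upper i j _ => zVar p q i j - wVar p q i j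
  | .nonneg i _ _ => -wVar p q i (min i q)

/-- The right-hand side of a constraint, written in the form `lhs ≤ rhs`. -/
def Constraint.rhs {p q : ℕ} : Constraint p q → ℝ
  | .top => 1
  | _ => 0

/-- The solution set of the compact system. -/
def compactPoly (p q : ℕ) : Set (Space p q) :=
  {v | ∀ c : Constraint p q, c.lhs v ≤ c.rhs}

/-- The variables of the compact system: the `z i j` and the `w i j`. -/
abbrev Var (p q : ℕ) : Type := inds p q ⊕ inds p q

/-- The value of a variable. -/
def Var.val {p q : ℕ} : Var p q → (Space p q →ₗ[ℝ] ℝ)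
  | Sum.inl a => LinearMap.proj a ∘ₗ LinearMap.fst ℝ _ _
  | Sum.inr a => LinearMap.proj a ∘ₗ LinearMap.snd ℝ _ _

/-- The unit vector of a variable. -/
def Var.unit {p q : ℕ} : Var p q → Space p q
  | Sum.inl a => (Pi.single a 1, 0)
  | Sum.inr a => (0, Pi.single a 1)

/-- The coefficient of a variable in a constraint. -/
def Constraint.coeff {p q : ℕ} (c : Constraint p q) (k : Var p q) : ℝ := c.lhs (Var.unit k)

/-- The constraints `w i q(i) ≥ 0` of the last family. -/
def Constraint.InNonnegFamily {p q : ℕ} : Constraint p q → Prop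
  | .nonneg _ _ _ => True
  | _ => False

/-- The constraint merely says that a single variable is nonnegative. -/
def Constraint.IsNonnegativity {p q : ℕ} (c : Constraint p q) : Prop :=
  (∃ k : Var p q, c.lhs = -Var.val k) ∧ c.rhs = 0

/-! ### Extended formulations -/

/-- A polytope is the convex hull of a finite set. -/
def IsPolytope {V : Type} [AddCommGroup V] [Module ℝ V] (Q : Set V) : Prop :=
  ∃ S : Set V, S.Finite ∧ Q = convexHull ℝ S

/-- `Q` is an extended formulation of `P`: a polytope which has `P` as a linear projection. -/
def IsExtendedFormulation {V W : Type} [AddCommGroup V] [Module ℝ V] [AddCommGroup W]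
    [Module ℝ W] (Q : Set V) (P : Set W) : Prop :=
  IsPolytope Q ∧ ∃ π : V →ₗ[ℝ] W, π '' Q = P

end

end Orbitope

open Orbitope

open Orbitope

namespace Orbitope

open MeasureTheory Set

/-! ### Coordinates -/

/-! The core is integrality: every point `(z,w)` of the compact polytope is an average of its
`0/1`-points over a uniform parameter `t` in `[0,1)`. Let `W i j = [0, w i j)`, and choose in each
row sets `Z i j` of length `z i j`, decreasing in `j`, with `[w (i-1) j, w i j) ⊆ Z i j ⊆ [0, w i
j)`. They are built from the last column leftwards (`exists_nested_sets`). For fixed `t` the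
indicators of `t ∈ Z i j` and `t ∈ W i j` again satisfy the system, and integration over `t` returns
`(z,w)` (`mem_convexHull_zeroOnePoints`). If `w 1 1 = 1`, every `t` lies in `W 1 1`, so the face is
integral for the same reason.

For `0/1`-points everything is combinatorial. Columns of a packing matrix are sorted iff each `1`
has a `1` strictly above it in every column to its left (`antitone_toLex_iff`). In a `0/1`-solution
each row of `z` drops from `1` to `0` at most once, which places the `1` of that row, and the jumps
in the columns of `w` supply the required `1`s above. Conversely, a sorted matrix arises from `z`
recording a `1` in row `i` from column `j` on, and `w` recording a `1` in column `j` down to row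
`i`. Linear maps commute with convex hulls, so both orbitopes follow.

In the change of variables, `z` and `w` are partial sums of `x` and of the diagonal arc values. The
values on the remaining arcs are forced by flow conservation (`eq_arcFlow`), and nonnegativity and
coupling translate into the compact constraints. The size bounds come from injective codes into a
few copies of `inds p q`. -/

theorem coord_of_mem {α : Type} [DecidableEq α] {S : Finset α} {a : α} (h : a ∈ S) (x : S → ℝ) :
    coord a x = x ⟨a, h⟩ := by
  simp [coord, h]

theorem coord_of_notMem {α : Type} [DecidableEq α] {S : Finset α} {a : α} (h : a ∉ S)
    (x : S → ℝ) : coord a x = 0 := by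
  simp [coord, h]

theorem total_apply {α : Type} [DecidableEq α] {S : Finset α} (N : Finset α) (x : S → ℝ) :
    total N x = ∑ a ∈ N, coord a x := by
  simp [total]

theorem mem_inds {p q i j : ℕ} : (i, j) ∈ inds p q ↔ 1 ≤ j ∧ j ≤ i ∧ i ≤ p ∧ j ≤ q := by
  simp only [inds, Finset.mem_filter, Finset.mem_product, Finset.mem_Icc]
  omega

theorem zVar_apply {p q i j : ℕ} (v : Space p q) : zVar p q i j v = coord (i, j) v.1 := rfl

theorem wVar_apply {p q i j : ℕ} (v : Space p q) : wVar p q i j v = coord (i, j) v.2 := rfl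

/-- The point of `Space p q` with the given coordinates at the positions in `inds p q`. -/
def ofFuns (p q : ℕ) (z w : ℕ → ℕ → ℝ) : Space p q :=
  (fun a => z a.1.1 a.1.2, fun a => w a.1.1 a.1.2)

theorem zVar_ofFuns {p q : ℕ} {z w : ℕ → ℕ → ℝ} (hz : ∀ i j, (i, j) ∉ inds p q → z i j = 0)
    (i j : ℕ) : zVar p q i j (ofFuns p q z w) = z i j := by
  by_cases h : (i, j) ∈ inds p q
  · rw [zVar_apply, coord_of_mem h]; rfl
  · rw [zVar_apply, coord_of_notMem h, hz i j h]

theorem wVar_ofFuns {p q : ℕ} {z w : ℕ → ℕ → ℝ} (hw : ∀ i j, (i, j) ∉ inds p q → w i j = 0)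
    (i j : ℕ) : wVar p q i j (ofFuns p q z w) = w i j := by
  by_cases h : (i, j) ∈ inds p q
  · rw [wVar_apply, coord_of_mem h]; rfl
  · rw [wVar_apply, coord_of_notMem h, hw i j h]

/-! ### The compact system in terms of functions -/

/-- The functions `z`, `w` vanish off `inds p q` and satisfy the compact system; the range of
the indices is extended to where the constraints hold trivially. -/
structure Feasible (p q : ℕ) (z w : ℕ → ℕ → ℝ) : Prop where
  z_off : ∀ i j, (i, j) ∉ inds p q → z i j = 0
  w_off : ∀ i j, (i, j) ∉ inds p q → w i j = 0
  mono : ∀ i j, i < p → w i (j + 1) ≤ w (i + 1) (j + 1)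
  shift : ∀ i j, i < p → w (i + 1) (j + 2) ≤ w i (j + 1)
  top : w p 1 ≤ 1
  lower : ∀ i j, i < p → w (i + 1) (j + 1) - w i (j + 1) ≤ z (i + 1) (j + 1) - z (i + 1) (j + 2)
  upper : ∀ i j, z i j ≤ w i j

namespace Feasible

variable {p q : ℕ} {z w : ℕ → ℕ → ℝ}

/-- Every column of `w` starts with a `0` in row `0` and grows downwards by `mono`. The last family
of constraints is therefore implied, and `Feasible` has no field for it. -/
theorem w_nonneg (h : Feasible p q z w) (i j : ℕ) : 0 ≤ w i j := by
  induction i with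
  | zero => rw [h.w_off 0 j (by rw [mem_inds]; omega)]
  | succ i ih =>
    by_cases hi : (i + 1, j) ∈ inds p q
    · rw [mem_inds] at hi
      obtain ⟨j, rfl⟩ : ∃ k, j = k + 1 := ⟨j - 1, by omega⟩
      exact ih.trans (h.mono i j (by omega))
    · rw [h.w_off _ _ hi]

theorem w_mono (h : Feasible p q z w) {i k : ℕ} (hik : i ≤ k) (hk : k ≤ p) (j : ℕ) :
    w i (j + 1) ≤ w k (j + 1) := by
  induction k, hik using Nat.le_induction with
  | base => exact le_rfl
  | succ k hik ih => exact (ih (by omega)).trans (h.mono k j (by omega))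

/-- One diagonal step up by `shift`, then one vertical step down by `mono`. -/
theorem w_anti (h : Feasible p q z w) (i j : ℕ) : w i (j + 2) ≤ w i (j + 1) := by
  by_cases hi : (i, j + 2) ∈ inds p q
  · rw [mem_inds] at hi
    obtain ⟨i, rfl⟩ : ∃ k, i = k + 1 := ⟨i - 1, by omega⟩
    exact (h.shift i j (by omega)).trans (h.mono i j (by omega))
  · rw [h.w_off _ _ hi]
    exact h.w_nonneg _ _

theorem w_antitone (h : Feasible p q z w) (i : ℕ) : Antitone fun j => w i (j + 1) :=
  antitone_nat_of_succ_le fun j => h.w_anti i j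

/-- Go down the column to row `p`, then left to column `1`, where `top` applies. -/
theorem w_le_one (h : Feasible p q z w) (i j : ℕ) : w i j ≤ 1 := by
  by_cases hi : (i, j) ∈ inds p q
  · rw [mem_inds] at hi
    obtain ⟨j, rfl⟩ : ∃ k, j = k + 1 := ⟨j - 1, by omega⟩
    exact ((h.w_mono hi.2.2.1 le_rfl j).trans (h.w_antitone p (Nat.zero_le j))).trans h.top
  · rw [h.w_off _ _ hi]
    exact zero_le_one

/-- By `lower` the drop of `z` is at least the increment of `w`, which `mono` makes nonnegative. -/
theorem z_anti (h : Feasible p q z w) (i j : ℕ) : z i (j + 2) ≤ z i (j + 1) := by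
  by_cases hi : (i, j + 1) ∈ inds p q
  · rw [mem_inds] at hi
    obtain ⟨i, rfl⟩ : ∃ k, i = k + 1 := ⟨i - 1, by omega⟩
    linarith [h.lower i j (by omega), h.mono i j (by omega)]
  · rw [h.z_off _ _ hi, h.z_off]
    rw [mem_inds] at hi ⊢
    omega

theorem z_nonneg (h : Feasible p q z w) (i j : ℕ) : 0 ≤ z i j := by
  by_cases hj : j = 0
  · rw [h.z_off i j (by rw [mem_inds]; omega)]
  · obtain ⟨j, rfl⟩ : ∃ k, j = k + 1 := ⟨j - 1, by omega⟩
    have hz : z i (max j q + 1) = 0 := h.z_off _ _ (by rw [mem_inds]; omega)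
    rw [← hz]
    exact antitone_nat_of_succ_le (f := fun j => z i (j + 1)) (fun j => h.z_anti i j)
      (le_max_left j q)

end Feasible

theorem feasible_of_mem {p q : ℕ} {v : Space p q} (hv : v ∈ compactPoly p q) :
    Feasible p q (fun i j => zVar p q i j v) (fun i j => wVar p q i j v) where
  z_off i j h := coord_of_notMem h _
  w_off i j h := coord_of_notMem h _
  mono i j hi := by
    by_cases hj : j < min (i + 1) q
    · simpa [Constraint.lhs, Constraint.rhs] using hv (.diag i j hi hj)
    · rw [wVar_apply, wVar_apply, coord_of_notMem, coord_of_notMem] <;> rw [mem_inds] <;> omega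
  shift i j hi := by
    by_cases h : (i, j + 1) ∈ inds p q
    · simpa [Constraint.lhs, Constraint.rhs] using hv (.vert i (j + 1) h hi)
    · rw [mem_inds] at h
      rw [wVar_apply, wVar_apply, coord_of_notMem, coord_of_notMem] <;> rw [mem_inds] <;> omega
  top := by simpa [Constraint.lhs, Constraint.rhs] using hv .top
  lower i j hi := by
    by_cases h : (i + 1, j + 1) ∈ inds p q
    · have := hv (.lower (i + 1) (j + 1) h)
      simp only [Constraint.lhs, Constraint.rhs, LinearMap.add_apply, LinearMap.sub_apply,
        Nat.add_sub_cancel] at this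
      linarith
    · rw [mem_inds] at h
      simp only [wVar_apply, zVar_apply]
      rw [coord_of_notMem, coord_of_notMem, coord_of_notMem, coord_of_notMem] <;>
        rw [mem_inds] <;> omega
  upper i j := by
    by_cases h : (i, j) ∈ inds p q
    · simpa [Constraint.lhs, Constraint.rhs] using hv (.upper i j h)
    · rw [wVar_apply, zVar_apply, coord_of_notMem h, coord_of_notMem h]

theorem Feasible.ofFuns_mem {p q : ℕ} {z w : ℕ → ℕ → ℝ} (h : Feasible p q z w) :
    ofFuns p q z w ∈ compactPoly p q := by
  intro c
  cases c with
  | diag i j hi hj =>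
    simpa [Constraint.lhs, Constraint.rhs, wVar_ofFuns h.w_off] using h.mono i j hi
  | vert i j hij hi =>
    rw [mem_inds] at hij
    obtain ⟨j, rfl⟩ : ∃ k, j = k + 1 := ⟨j - 1, by omega⟩
    simpa [Constraint.lhs, Constraint.rhs, wVar_ofFuns h.w_off] using h.shift i j hi
  | top => simpa [Constraint.lhs, Constraint.rhs, wVar_ofFuns h.w_off] using h.top
  | lower i j hij =>
    rw [mem_inds] at hij
    obtain ⟨j, rfl⟩ : ∃ k, j = k + 1 := ⟨j - 1, by omega⟩
    obtain ⟨i, rfl⟩ : ∃ k, i = k + 1 := ⟨i - 1, by omega⟩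
    have := h.lower i j (by omega)
    simp only [Constraint.lhs, Constraint.rhs, LinearMap.add_apply, LinearMap.sub_apply,
      wVar_ofFuns h.w_off, zVar_ofFuns h.z_off, Nat.add_sub_cancel]
    linarith
  | upper i j hij =>
    simpa [Constraint.lhs, Constraint.rhs, wVar_ofFuns h.w_off, zVar_ofFuns h.z_off]
      using h.upper i j
  | nonneg i hi hip =>
    simpa [Constraint.lhs, Constraint.rhs, wVar_ofFuns h.w_off] using h.w_nonneg i (min i q)

theorem compactPoly_convex (p q : ℕ) : Convex ℝ (compactPoly p q) := by
  rw [compactPoly, ofPred_forall]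
  exact convex_iInter fun c => convex_halfSpace_le c.lhs.isLinear _

/-! ### Integrality -/

/-- A subset of `[0,u)` can be enlarged within `[0,u)` to any prescribed larger length. -/
theorem exists_superset_measureReal_eq {S : Set ℝ} {u r : ℝ} (hS : MeasurableSet S)
    (hu : 0 ≤ u) (hSu : S ⊆ Ico 0 u) (hr : volume.real S ≤ r) (hru : r ≤ u) :
    ∃ T, MeasurableSet T ∧ S ⊆ T ∧ T ⊆ Ico 0 u ∧ volume.real T = r := by
  have hfin : ∀ a, volume (S ∪ Ico 0 a) ≠ ⊤ := fun a =>
    measure_union_ne_top (measure_ne_top_of_subset hSu (by simp)) (by simp)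
  -- The length of `S ∪ [0,a)` depends continuously on `a` and runs from the length of `S` at `a =
  -- 0` to `u` at `a = u`; the intermediate value theorem yields `T`.
  have hf : LipschitzWith 1 fun a : ℝ => volume.real (S ∪ Ico 0 a) := by
    refine LipschitzWith.of_le_add fun b a => ?_
    have hsub : S ∪ Ico 0 b ⊆ (S ∪ Ico 0 a) ∪ Ico a b := by
      rintro x (hx | hx)
      · exact Or.inl (Or.inl hx)
      · rcases lt_or_ge x a with h | h
        · exact Or.inl (Or.inr ⟨hx.1, h⟩)
        · exact Or.inr ⟨h, hx.2⟩
    calc volume.real (S ∪ Ico 0 b) ≤ volume.real ((S ∪ Ico 0 a) ∪ Ico a b) :=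
          measureReal_mono hsub (measure_union_ne_top (hfin a) (by simp))
      _ ≤ volume.real (S ∪ Ico 0 a) + volume.real (Ico a b) := measureReal_union_le _ _
      _ ≤ volume.real (S ∪ Ico 0 a) + dist b a := by
          gcongr
          rw [Real.volume_real_Ico, Real.dist_eq]
          exact max_le (le_abs_self _) (abs_nonneg _)
  have h0 : volume.real (S ∪ Ico 0 0) ≤ r := by simpa using hr
  have h1 : r ≤ volume.real (S ∪ Ico 0 u) := by
    rw [union_eq_self_of_subset_left hSu, Real.volume_real_Ico]
    simpa using Or.inl hru
  obtain ⟨a, ha, har⟩ := intermediate_value_Icc hu hf.continuous.continuousOn ⟨h0, h1⟩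
  exact ⟨S ∪ Ico 0 a, hS.union measurableSet_Ico, subset_union_left,
    union_subset hSu (Ico_subset_Ico_right ha.2), har⟩

/-- Nested sets of prescribed lengths `z j` between `[v j, u j)` and `[0, u j)`. -/
theorem exists_nested_sets (n : ℕ) : ∀ u v z : ℕ → ℝ, (∀ j, n ≤ j → z j = 0) →
    (∀ j, 0 ≤ u j) → (∀ j, v j ≤ u j) → (∀ j, u (j + 1) ≤ v j) →
    (∀ j, u j - v j ≤ z j - z (j + 1)) → (∀ j, z j ≤ u j) →
    ∃ Z : ℕ → Set ℝ, ∀ j, MeasurableSet (Z j) ∧ Z (j + 1) ⊆ Z j ∧ Z j ⊆ Ico 0 (u j) ∧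
      Ico (v j) (u j) ⊆ Z j ∧ volume.real (Z j) = z j := by
  induction n with
  | zero =>
    intro u v z hz _ _ _ hl _
    refine ⟨fun _ => ∅, fun j => ⟨MeasurableSet.empty, subset_rfl, empty_subset _, ?_, ?_⟩⟩
    · have := hl j
      rw [hz j (Nat.zero_le _), hz (j + 1) (Nat.zero_le _)] at this
      rw [Ico_eq_empty (by linarith)]
    · rw [hz j (Nat.zero_le _)]
      simp
  | succ n ih =>
    intro u v z hz hu hvu huv hl hzu
    -- The columns to the right come first. The new set must contain `Z 0` and `[v 0, u 0)`; their
    -- union has length at most `z 1 + (u 0 - v 0) ≤ z 0`, so it can be enlarged inside `[0, u 0)`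
    -- to length `z 0`.
    obtain ⟨Z, hZ⟩ := ih (fun j => u (j + 1)) (fun j => v (j + 1)) (fun j => z (j + 1))
      (fun j hj => hz _ (by omega)) (fun j => hu _) (fun j => hvu _) (fun j => huv _)
      (fun j => hl _) (fun j => hzu _)
    have hv0 : 0 ≤ v 0 := (hu 1).trans (huv 0)
    have hsub : Z 0 ∪ Ico (v 0) (u 0) ⊆ Ico 0 (u 0) :=
      union_subset ((hZ 0).2.2.1.trans (Ico_subset_Ico_right ((huv 0).trans (hvu 0))))
        (Ico_subset_Ico_left hv0)
    have hlen : volume.real (Z 0 ∪ Ico (v 0) (u 0)) ≤ z 0 := by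
      refine (measureReal_union_le _ _).trans ?_
      rw [(hZ 0).2.2.2.2, Real.volume_real_Ico_of_le (hvu 0)]
      linarith [hl 0]
    obtain ⟨T, hT, hST, hTu, hTz⟩ := exists_superset_measureReal_eq
      ((hZ 0).1.union measurableSet_Ico) (hu 0) hsub hlen (hzu 0)
    refine ⟨fun j => Nat.casesOn j T Z, fun j => ?_⟩
    cases j with
    | zero => exact ⟨hT, subset_union_left.trans hST, hTu, subset_union_right.trans hST, hTz⟩
    | succ j => exact hZ j

/-- The points of the compact polytope with all coordinates in `{0,1}`. -/
def zeroOnePoints (p q : ℕ) : Set (Space p q) :=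
  {v ∈ compactPoly p q | (∀ a, v.1 a = 0 ∨ v.1 a = 1) ∧ ∀ a, v.2 a = 0 ∨ v.2 a = 1}

theorem zeroOnePoints_finite (p q : ℕ) : (zeroOnePoints p q).Finite := by
  have hfin : (Set.univ.pi fun _ : inds p q => ({0, 1} : Set ℝ)).Finite :=
    Set.Finite.pi fun _ => by simp
  refine (hfin.prod hfin).subset fun v hv => ⟨fun a _ => ?_, fun a _ => ?_⟩
  · simpa using hv.2.1 a
  · simpa using hv.2.2 a

/-- A point whose coordinates are the lengths of subsets of `[0,1)` lies in the convex hull of the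
incidence vectors of the members of `[0,1)`. -/
theorem mem_convexHull_of_sets {p q : ℕ} {S : Set (Space p q)} (hS : S.Finite) {v : Space p q}
    (Z W : ℕ → ℕ → Set ℝ) (hZ : ∀ i j, MeasurableSet (Z i j)) (hW : ∀ i j, MeasurableSet (W i j))
    (hZv : ∀ i j, volume.real (Z i j ∩ Ico 0 1) = zVar p q i j v)
    (hWv : ∀ i j, volume.real (W i j ∩ Ico 0 1) = wVar p q i j v)
    (hmem : ∀ t ∈ Ico (0 : ℝ) 1, ofFuns p q (fun i j => (Z i j).indicator 1 t)
      (fun i j => (W i j).indicator 1 t) ∈ S) :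
    v ∈ convexHull ℝ S := by
  set f : ℝ → Space p q := fun t => ofFuns p q (fun i j => (Z i j).indicator 1 t)
    (fun i j => (W i j).indicator 1 t) with hf
  set μ : Measure ℝ := volume.restrict (Ico 0 1) with hμ
  have : IsProbabilityMeasure μ := ⟨by simp [hμ]⟩
  have hmeas : Measurable f := by
    refine Measurable.prodMk ?_ ?_ <;> refine measurable_pi_iff.2 fun a => ?_
    · exact measurable_one.indicator (hZ _ _)
    · exact measurable_one.indicator (hW _ _)
  have hbound : ∀ t, ‖f t‖ ≤ 1 := by
    intro t
    rw [Prod.norm_def]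
    refine max_le ?_ ?_ <;>
      refine (pi_norm_le_iff_of_nonneg zero_le_one).2 fun a => ?_
    · exact (norm_indicator_le_norm_self _ _).trans (by simp)
    · exact (norm_indicator_le_norm_self _ _).trans (by simp)
  have hint : Integrable f μ :=
    Integrable.of_bound hmeas.stronglyMeasurable.aestronglyMeasurable 1
      (Filter.Eventually.of_forall hbound)
  have hval : ∀ A : Set ℝ, MeasurableSet A →
      ∫ t, A.indicator (1 : ℝ → ℝ) t ∂μ = volume.real (A ∩ Ico 0 1) := by
    intro A hA
    rw [integral_indicator_one hA, hμ, measureReal_restrict_apply hA]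
  -- `v` is the mean of `f`; this is checked coordinatewise, each coordinate projection being a
  -- continuous linear map.
  have hv : ∫ t, f t ∂μ = v := by
    refine Prod.ext (funext fun a => ?_) (funext fun a => ?_)
    · have := ((ContinuousLinearMap.proj (R := ℝ) (φ := fun _ : inds p q => ℝ) a).comp
        (ContinuousLinearMap.fst ℝ (inds p q → ℝ) (inds p q → ℝ))).integral_comp_comm hint
      refine this.symm.trans ((hval _ (hZ a.1.1 a.1.2)).trans ?_)
      rw [hZv, zVar_apply, coord_of_mem a.2]
    · have := ((ContinuousLinearMap.proj (R := ℝ) (φ := fun _ : inds p q => ℝ) a).comp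
        (ContinuousLinearMap.snd ℝ (inds p q → ℝ) (inds p q → ℝ))).integral_comp_comm hint
      refine this.symm.trans ((hval _ (hW a.1.1 a.1.2)).trans ?_)
      rw [hWv, wVar_apply, coord_of_mem a.2]
  rw [← hv]
  -- A mean of points of a closed convex set stays in the set; the hull is closed because `S` is
  -- finite.
  refine (convex_convexHull ℝ S).integral_mem (hS.isClosed_convexHull ℝ) ?_ hint
  refine (ae_restrict_iff' measurableSet_Ico).2 (Filter.Eventually.of_forall fun t ht => ?_)
  exact subset_convexHull ℝ S (hmem t ht)

/-- Every point of the compact polytope is a convex combination of `0/1`-points on the same side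
of the face `w 1 1 = 1`. -/
theorem mem_convexHull_zeroOnePoints {p q : ℕ} {v : Space p q} (hv : v ∈ compactPoly p q) :
    v ∈ convexHull ℝ {u ∈ zeroOnePoints p q | wVar p q 1 1 v = 1 → wVar p q 1 1 u = 1} := by
  have h := feasible_of_mem hv
  set z : ℕ → ℕ → ℝ := fun i j => zVar p q i j v with hz
  set w : ℕ → ℕ → ℝ := fun i j => wVar p q i j v with hw
  -- Rows are treated independently: `u` and `v` are rows `i + 1` and `i` of `w`, and the hypotheses
  -- on them are `mono`, `shift`, `lower` and `upper`.
  have hrow : ∀ i, ∃ Z : ℕ → Set ℝ, i < p → ∀ j, MeasurableSet (Z j) ∧ Z (j + 1) ⊆ Z j ∧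
      Z j ⊆ Ico 0 (w (i + 1) (j + 1)) ∧ Ico (w i (j + 1)) (w (i + 1) (j + 1)) ⊆ Z j ∧
      volume.real (Z j) = z (i + 1) (j + 1) := by
    intro i
    by_cases hi : i < p
    · obtain ⟨Z, hZ⟩ := exists_nested_sets q (fun j => w (i + 1) (j + 1)) (fun j => w i (j + 1))
        (fun j => z (i + 1) (j + 1)) (fun j hj => h.z_off _ _ (by rw [mem_inds]; omega))
        (fun j => h.w_nonneg _ _) (fun j => h.mono i j hi) (fun j => h.shift i j hi)
        (fun j => h.lower i j hi) (fun j => h.upper _ _)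
      exact ⟨Z, fun _ => hZ⟩
    · exact ⟨fun _ => ∅, fun hi' => absurd hi' hi⟩
  choose Z hZ using hrow
  -- `Z` is indexed from `0`; `Z'` shifts it to the indices of `inds p q` and is empty elsewhere.
  set Z' : ℕ → ℕ → Set ℝ := fun i j => if (i, j) ∈ inds p q then Z (i - 1) (j - 1) else ∅ with hZ'
  have hin : ∀ i j, (i + 1, j + 1) ∈ inds p q → Z' (i + 1) (j + 1) = Z i j := by
    intro i j hij
    simp [hZ', hij]
  have hoff : ∀ i j, (i, j) ∉ inds p q → Z' i j = ∅ := by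
    intro i j hij
    simp [hZ', hij]
  have hcases : ∀ i j, (∃ k l, i = k + 1 ∧ j = l + 1 ∧ (k + 1, l + 1) ∈ inds p q ∧ k < p ∧
      Z' i j = Z k l) ∨ ((i, j) ∉ inds p q ∧ Z' i j = ∅) := by
    intro i j
    by_cases hij : (i, j) ∈ inds p q
    · obtain ⟨k, rfl⟩ : ∃ k, i = k + 1 := ⟨i - 1, by rw [mem_inds] at hij; omega⟩
      obtain ⟨l, rfl⟩ : ∃ k, j = k + 1 := ⟨j - 1, by rw [mem_inds] at hij; omega⟩
      exact Or.inl ⟨k, l, rfl, rfl, hij, by rw [mem_inds] at hij; omega, hin k l hij⟩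
    · exact Or.inr ⟨hij, hoff i j hij⟩
  have hsubW : ∀ i j, Z' i j ⊆ Ico 0 (w i j) := by
    intro i j
    rcases hcases i j with ⟨k, l, rfl, rfl, -, hk, hkl⟩ | ⟨-, hij⟩
    · rw [hkl]; exact (hZ k hk l).2.2.1
    · rw [hij]; exact empty_subset _
  have hW1 : ∀ i j, Ico 0 (w i j) ⊆ Ico 0 1 := fun i j => Ico_subset_Ico_right (h.w_le_one i j)
  refine mem_convexHull_of_sets ((zeroOnePoints_finite p q).subset (sep_subset _ _)) Z'
    (fun i j => Ico 0 (w i j)) ?_ (fun _ _ => measurableSet_Ico) ?_ ?_ ?_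
  · intro i j
    rcases hcases i j with ⟨k, l, rfl, rfl, -, hk, hkl⟩ | ⟨-, hij⟩
    · rw [hkl]; exact (hZ k hk l).1
    · rw [hij]; exact MeasurableSet.empty
  · intro i j
    rw [inter_eq_left.2 ((hsubW i j).trans (hW1 i j))]
    rcases hcases i j with ⟨k, l, rfl, rfl, -, hk, hkl⟩ | ⟨hij, hij'⟩
    · rw [hkl]; exact (hZ k hk l).2.2.2.2
    · rw [hij']
      simpa using (h.z_off i j hij).symm
  · intro i j
    rw [inter_eq_left.2 (hW1 i j), Real.volume_real_Ico_of_le (h.w_nonneg i j), sub_zero]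
  · intro t ht
    have hindW : ∀ i j, (Ico 0 (w i j)).indicator (1 : ℝ → ℝ) t = if t < w i j then 1 else 0 := by
      intro i j
      simp [indicator, ht.1]
    have hF : Feasible p q (fun i j => (Z' i j).indicator 1 t)
        (fun i j => (Ico 0 (w i j)).indicator 1 t) :=
      { z_off := fun i j hij => by simp [hoff i j hij]
        w_off := fun i j hij => by rw [h.w_off i j hij]; simp
        mono := fun i j hi => indicator_le_indicator_of_subset
          (Ico_subset_Ico_right (h.mono i j hi)) (fun _ => zero_le_one) t
        shift := fun i j hi => indicator_le_indicator_of_subset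
          (Ico_subset_Ico_right (h.shift i j hi)) (fun _ => zero_le_one) t
        top := by simp only [hindW]; split_ifs <;> norm_num
        lower := fun i j hi => by
          by_cases hij : (i + 1, j + 1) ∈ inds p q
          · have hZj := hZ i hi j
            have hsub : Z' (i + 1) (j + 2) ⊆ Z i j := by
              by_cases hij2 : (i + 1, j + 1 + 1) ∈ inds p q
              · rw [hin i (j + 1) hij2]; exact hZj.2.1
              · rw [hoff _ _ hij2]; exact empty_subset _
            have hsub2 : Z' (i + 1) (j + 2) ⊆ Ico 0 (w i (j + 1)) :=
              (hsubW _ _).trans (Ico_subset_Ico_right (h.shift i j hi))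
            have hmono := h.mono i j hi
            simp only [hindW]
            rw [hin i j hij]
            -- If `t < w i (j + 1)`, the increment of `w` vanishes at `t` and nestedness suffices.
            -- Otherwise `t` is outside the next set of the row, which lies in `[0, w i (j + 1))` by
            -- `shift`; and if the increment is `1`, then `t` lies in `[w i (j + 1), w (i + 1) (j +
            -- 1))`, which `Z i j` contains.
            by_cases h1 : t < w i (j + 1)
            · have h2 : t < w (i + 1) (j + 1) := h1.trans_le hmono
              have := indicator_le_indicator_of_subset (f := (1 : ℝ → ℝ)) hsub
                (fun _ => zero_le_one) t
              rw [if_pos h1, if_pos h2]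
              linarith
            · have h3 : t ∉ Z' (i + 1) (j + 2) := fun h3 => h1 (hsub2 h3).2
              rw [if_neg h1, indicator_of_notMem h3]
              by_cases h2 : t < w (i + 1) (j + 1)
              · have h4 : t ∈ Z i j := hZj.2.2.2.1 ⟨not_lt.1 h1, h2⟩
                simp [h2, h4]
              · rw [if_neg h2]
                simpa using indicator_nonneg (f := (1 : ℝ → ℝ)) (fun _ _ => zero_le_one) t
          · have hij1 : (i, j + 1) ∉ inds p q := by rw [mem_inds] at hij ⊢; omega
            have hij2 : (i + 1, j + 2) ∉ inds p q := by rw [mem_inds] at hij ⊢; omega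
            rw [h.w_off _ _ hij, h.w_off _ _ hij1, hoff _ _ hij, hoff _ _ hij2]
            simp
        upper := fun i j => indicator_le_indicator_of_subset
          (hsubW i j) (fun _ => zero_le_one) t }
    refine ⟨⟨hF.ofFuns_mem, fun a => ?_, fun a => ?_⟩, fun h11 => ?_⟩
    · exact indicator_eq_zero_or_self _ _ _
    · exact indicator_eq_zero_or_self _ _ _
    · rw [wVar_ofFuns hF.w_off, hindW, hw]
      simp only [h11]
      exact if_pos ht.2

theorem compactPoly_eq_convexHull (p q : ℕ) :
    compactPoly p q = convexHull ℝ (zeroOnePoints p q) := by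
  refine Subset.antisymm (fun v hv => ?_) (convexHull_min (sep_subset _ _)
    (compactPoly_convex p q))
  exact convexHull_mono (sep_subset _ _) (mem_convexHull_zeroOnePoints hv)

theorem compactPoly_face_eq_convexHull (p q : ℕ) :
    {v ∈ compactPoly p q | wVar p q 1 1 v = 1} =
      convexHull ℝ {v ∈ zeroOnePoints p q | wVar p q 1 1 v = 1} := by
  refine Subset.antisymm (fun v hv => ?_) (convexHull_min (fun v hv => And.intro hv.1.1 hv.2) ?_)
  · refine convexHull_mono ?_ (mem_convexHull_zeroOnePoints hv.1)
    exact fun u hu => ⟨hu.1, hu.2 hv.2⟩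
  · exact (compactPoly_convex p q).inter (convex_hyperplane (wVar p q 1 1).isLinear 1)

/-! ### Sorted matrices and `0/1`-points of the compact polytope -/

/-- The sorted matrices with at most one `1` per row. -/
def packingMatrices (p q : ℕ) : Set (Matrix (Finset.Icc 1 p) (Finset.Icc 1 q) ℝ) :=
  {M ∈ sortedMatrices p q | ∀ i j j', M i j = 1 → M i j' = 1 → j = j'}

/-- The sorted matrices with exactly one `1` per row. -/
def partitioningMatrices (p q : ℕ) : Set (Matrix (Finset.Icc 1 p) (Finset.Icc 1 q) ℝ) :=
  {M ∈ sortedMatrices p q | ∀ i, ∃! j, M i j = 1}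

theorem partitioningMatrices_subset (p q : ℕ) :
    partitioningMatrices p q ⊆ packingMatrices p q :=
  fun _ hM => ⟨hM.1, fun i _ _ h h' => (hM.2 i).unique h h'⟩

/-- For a `0/1`-matrix with at most one `1` per row, the columns are lexicographically
non-increasing iff each `1` has a `1` strictly above it in every column to its left. -/
theorem antitone_toLex_iff {p q : ℕ} {M : Matrix (Finset.Icc 1 p) (Finset.Icc 1 q) ℝ}
    (h01 : ∀ i j, M i j = 0 ∨ M i j = 1) (hrow : ∀ i j j', M i j = 1 → M i j' = 1 → j = j') :
    (Antitone fun j => toLex fun i => M i j) ↔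
      ∀ j j', j < j' → ∀ i, M i j' = 1 → ∃ k, k < i ∧ M k j = 1 := by
  constructor
  · intro hM j j' hj i hi
    -- If column `j` had no `1` above row `i`, the induction hypothesis would leave column `j'`
    -- without one there too. The columns would then first differ in row `i`, in favour of `j'`.
    induction i using WellFoundedLT.induction with
    | ind i ih =>
      by_contra! hno
      have hbefore : ∀ k < i, M k j = 0 ∧ M k j' = 0 := by
        refine fun k hk => ⟨(h01 k j).resolve_right (hno k hk), (h01 k j').resolve_right ?_⟩
        intro hk'
        obtain ⟨l, hl, hl'⟩ := ih k hk hk'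
        exact hno l (hl.trans hk) hl'
      have hij : M i j = 0 := (h01 i j).resolve_right fun h => hj.ne (hrow i j j' h hi)
      have hlt : (toLex fun i => M i j) < toLex fun i => M i j' :=
        ⟨i, fun k hk => (hbefore k hk).1.trans (hbefore k hk).2.symm, by
          change M i j < M i j'
          rw [hij, hi]
          exact zero_lt_one⟩
      exact (hM hj.le).not_gt hlt
  · intro h j j' hjj'
    rcases hjj'.eq_or_lt with rfl | hj
    · exact le_rfl
    by_cases hex : ∃ i, M i j' = 1
    · obtain ⟨i, hi⟩ := hex
      have hne : {k | M k j = 1}.Nonempty := by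
        obtain ⟨k, -, hk⟩ := h j j' hj i hi
        exact ⟨k, hk⟩
      -- `k` is the topmost `1` of column `j`. A `1` of column `j'` in a row up to `k` would need a
      -- still higher one in column `j`, so row `k` decides the comparison.
      obtain ⟨k, hk, hmin⟩ := WellFounded.has_min (wellFounded_lt) _ hne
      have hj' : ∀ l ≤ k, M l j' = 0 := by
        refine fun l hl => (h01 l j').resolve_right fun hl' => ?_
        obtain ⟨m, hm, hm'⟩ := h j j' hj l hl'
        exact hmin m hm' (hm.trans_le hl)
      refine le_of_lt (α := Lex (Finset.Icc 1 p → ℝ)) ⟨k, fun l hl => ?_, ?_⟩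
      · exact (hj' l (le_of_lt hl)).trans ((h01 l j).resolve_right fun hl' => hmin l hl' hl).symm
      · change M k j' < M k j
        rw [hj' k le_rfl, hk]
        exact zero_lt_one
    · push Not at hex
      refine Pi.toLex_monotone fun i => ?_
      change M i j' ≤ M i j
      rw [(h01 i j').resolve_right (hex i)]
      rcases h01 i j with h | h <;> rw [h]
      exact zero_le_one

/-! ### From `0/1`-solutions to sorted matrices -/

namespace Feasible

variable {p q : ℕ} {z w : ℕ → ℕ → ℝ}

theorem exists_jump (h : Feasible p q z w) (hw : ∀ i j, w i j = 0 ∨ w i j = 1) {m j : ℕ}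
    (hm : w m (j + 1) = 1) : ∃ n < m, w n (j + 1) = 0 ∧ w (n + 1) (j + 1) = 1 := by
  induction m with
  | zero =>
    rw [h.w_off 0 (j + 1) (by rw [mem_inds]; omega)] at hm
    exact absurd hm zero_ne_one
  | succ m ih =>
    rcases hw m (j + 1) with h0 | h1
    · exact ⟨m, m.lt_succ_self, h0, hm⟩
    · obtain ⟨n, hn, hn'⟩ := ih h1
      exact ⟨n, hn.trans m.lt_succ_self, hn'⟩

/-- By `upper`, the entry forces a `1` in `w`, so that column of `w` jumps no later than row `i`. By
`shift` and `w_anti`, the column further left is already `1` one row before this jump, so its own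
jump lies strictly above row `i`. By `lower`, a jump of `w` forces an entry `1`. -/
theorem exists_entry_above (h : Feasible p q z w) (hz : ∀ i j, z i j = 0 ∨ z i j = 1)
    (hw : ∀ i j, w i j = 0 ∨ w i j = 1) {i j j' : ℕ} (hi : i ≤ p) (hj : j < j')
    (hone : z i (j' + 1) - z i (j' + 2) = 1) :
    ∃ k, 1 ≤ k ∧ k < i ∧ z k (j + 1) - z k (j + 2) = 1 := by
  have hz1 : z i (j' + 1) = 1 := by
    rcases hz i (j' + 1) with h0 | h1
    · linarith [h.z_nonneg i (j' + 2)]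
    · exact h1
  have hw1 : w i (j' + 1) = 1 :=
    le_antisymm (h.w_le_one _ _) (hz1 ▸ h.upper i (j' + 1))
  obtain ⟨m, hm, -, hm1⟩ := h.exists_jump hw hw1
  obtain ⟨b, rfl⟩ : ∃ b, j' = b + 1 := ⟨j' - 1, by omega⟩
  have hwm : w m (j + 1) = 1 := by
    refine le_antisymm (h.w_le_one _ _) ?_
    rw [← hm1]
    exact (h.shift m b (by omega)).trans (h.w_antitone m (show j ≤ b by omega))
  obtain ⟨n, hn, hn0, hn1⟩ := h.exists_jump hw hwm
  refine ⟨n + 1, by omega, by omega, ?_⟩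
  have := h.lower n j (by omega)
  rcases hz (n + 1) (j + 1) with h0 | h1 <;> linarith [h.z_nonneg (n + 1) (j + 2)]

/-- Each row of `z` is a non-increasing `0/1`-sequence, so it has at most one drop; the order of the
columns comes from `exists_entry_above`. -/
theorem packingMatrix (h : Feasible p q z w) (hz : ∀ i j, z i j = 0 ∨ z i j = 1)
    (hw : ∀ i j, w i j = 0 ∨ w i j = 1) :
    (fun i j => z i.1 j.1 - z i.1 (j.1 + 1) :
      Matrix (Finset.Icc 1 p) (Finset.Icc 1 q) ℝ) ∈ packingMatrices p q := by
  set M : Matrix (Finset.Icc 1 p) (Finset.Icc 1 q) ℝ := fun i j => z i.1 j.1 - z i.1 (j.1 + 1)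
    with hM
  have hanti : ∀ i {j : ℕ}, 1 ≤ j → z i (j + 1) ≤ z i j := by
    intro i j hj
    obtain ⟨j, rfl⟩ : ∃ k, j = k + 1 := ⟨j - 1, by omega⟩
    exact h.z_anti i j
  have h01 : ∀ i j, M i j = 0 ∨ M i j = 1 := by
    intro i j
    have := hanti i.1 (Finset.mem_Icc.1 j.2).1
    simp only [hM]
    rcases hz i.1 j.1 with h0 | h0 <;> rcases hz i.1 (j.1 + 1) with h1 | h1 <;> grind
  have hzz : ∀ i j, M i j = 1 → z i.1 j.1 = 1 ∧ z i.1 (j.1 + 1) = 0 := by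
    intro i j hij
    simp only [hM] at hij
    rcases hz i.1 j.1 with h0 | h0 <;> rcases hz i.1 (j.1 + 1) with h1 | h1 <;> grind
  have hlt : ∀ i j j', j < j' → M i j = 1 → M i j' = 1 → False := by
    intro i j j' hj h1 h2
    have hj1 := (Finset.mem_Icc.1 j.2).1
    have hj' : j.1 < j'.1 := hj
    have := antitone_nat_of_succ_le (f := fun j => z i.1 (j + 1)) (fun j => h.z_anti i j)
      (show j.1 ≤ j'.1 - 1 by omega)
    simp only [show j'.1 - 1 + 1 = j'.1 by omega, (hzz i j h1).2, (hzz i j' h2).1] at this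
    linarith
  have hrow : ∀ i j j', M i j = 1 → M i j' = 1 → j = j' := by
    intro i j j' h1 h2
    rcases lt_trichotomy j j' with hj | hj | hj
    · exact (hlt i j j' hj h1 h2).elim
    · exact hj
    · exact (hlt i j' j hj h2 h1).elim
  refine ⟨⟨h01, (antitone_toLex_iff h01 hrow).2 ?_⟩, hrow⟩
  intro j j' hj i hi
  have hj1 := (Finset.mem_Icc.1 j.2).1
  have hj' : j.1 < j'.1 := hj
  have hi' := Finset.mem_Icc.1 i.2
  simp only [hM] at hi ⊢
  obtain ⟨k, hk1, hki, hk⟩ := h.exists_entry_above hz hw (j := j.1 - 1) (j' := j'.1 - 1) hi'.2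
    (by omega) (by
      rwa [show j'.1 - 1 + 1 = j'.1 by omega, show j'.1 - 1 + 2 = j'.1 + 1 by omega])
  rw [show j.1 - 1 + 1 = j.1 by omega, show j.1 - 1 + 2 = j.1 + 1 by omega] at hk
  exact ⟨⟨k, Finset.mem_Icc.2 ⟨hk1, by omega⟩⟩, hki, hk⟩

/-- The row of `z` starts at `1` and is `0` in column `q + 1`, so it drops in between. -/
theorem exists_entry_of_row (h : Feasible p q z w) (hz : ∀ i j, z i j = 0 ∨ z i j = 1) {i : ℕ}
    (hi : z i 1 = 1) : ∃ j, j ∈ Finset.Icc 1 q ∧ z i j - z i (j + 1) = 1 := by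
  by_contra! hno
  have hone : ∀ j, z i (j + 1) = 1 := by
    intro j
    induction j with
    | zero => exact hi
    | succ j ih =>
      have hj : (i, j + 1) ∈ inds p q := by
        by_contra hj
        rw [h.z_off _ _ hj] at ih
        exact zero_ne_one ih
      rw [mem_inds] at hj
      refine (hz i (j + 2)).resolve_left fun h0 => ?_
      refine hno (j + 1) (Finset.mem_Icc.2 ⟨by omega, hj.2.2.2⟩) ?_
      rw [ih, h0, sub_zero]
  have := h.z_off i (q + 1) (by rw [mem_inds]; omega)
  rw [hone q] at this
  exact one_ne_zero this

end Feasible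

/-- The entries of a matrix as a function on `ℕ × ℕ`. -/
noncomputable def entry {p q : ℕ} (M : Matrix (Finset.Icc 1 p) (Finset.Icc 1 q) ℝ) (i j : ℕ) : ℝ :=
  if h : i ∈ Finset.Icc 1 p ∧ j ∈ Finset.Icc 1 q then M ⟨i, h.1⟩ ⟨j, h.2⟩ else 0

/-! ### From sorted matrices to `0/1`-solutions -/

section

variable {p q : ℕ} {M : Matrix (Finset.Icc 1 p) (Finset.Icc 1 q) ℝ}

theorem entry_coe (i : Finset.Icc 1 p) (j : Finset.Icc 1 q) : entry M i.1 j.1 = M i j := by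
  simp only [entry, dif_pos (And.intro i.2 j.2)]

theorem exists_of_entry_eq_one {i j : ℕ} (h : entry M i j = 1) :
    ∃ (hi : i ∈ Finset.Icc 1 p) (hj : j ∈ Finset.Icc 1 q), M ⟨i, hi⟩ ⟨j, hj⟩ = 1 := by
  by_cases hij : i ∈ Finset.Icc 1 p ∧ j ∈ Finset.Icc 1 q
  · exact ⟨hij.1, hij.2, by rwa [entry, dif_pos hij] at h⟩
  · rw [entry, dif_neg hij] at h
    exact absurd h zero_ne_one

theorem entry_eq_zero_or_one (hM : M ∈ packingMatrices p q) (i j : ℕ) :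
    entry M i j = 0 ∨ entry M i j = 1 := by
  by_cases hij : i ∈ Finset.Icc 1 p ∧ j ∈ Finset.Icc 1 q
  · rw [entry, dif_pos hij]; exact hM.1.1 _ _
  · rw [entry, dif_neg hij]; exact Or.inl rfl

theorem entry_unique (hM : M ∈ packingMatrices p q) {i j j' : ℕ} (h : entry M i j = 1)
    (h' : entry M i j' = 1) : j = j' := by
  obtain ⟨hi, hj, h1⟩ := exists_of_entry_eq_one h
  obtain ⟨_, hj', h2⟩ := exists_of_entry_eq_one h'
  exact congrArg Subtype.val (hM.2 _ _ _ h1 h2)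

theorem exists_entry_above (hM : M ∈ packingMatrices p q) {i j j' : ℕ} (hj1 : 1 ≤ j)
    (hjj' : j < j') (h : entry M i j' = 1) : ∃ k < i, entry M k j = 1 := by
  obtain ⟨hi, hj', h1⟩ := exists_of_entry_eq_one h
  have hj : j ∈ Finset.Icc 1 q := by
    rw [Finset.mem_Icc] at hj' ⊢
    omega
  obtain ⟨k, hk, hk1⟩ := (antitone_toLex_iff hM.1.1 hM.2).1 hM.1.2 ⟨j, hj⟩ ⟨j', hj'⟩ hjj' _ h1
  exact ⟨k.1, hk, (entry_coe k ⟨j, hj⟩).trans hk1⟩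

/-- Each step to the left leads to a `1` in a strictly higher row, so a `1` in column `j` cannot be
above row `j`. -/
theorem entry_mem_inds (hM : M ∈ packingMatrices p q) {i j : ℕ} (h : entry M i j = 1) :
    (i, j) ∈ inds p q := by
  obtain ⟨hi, hj, -⟩ := exists_of_entry_eq_one h
  rw [Finset.mem_Icc] at hi hj
  suffices j ≤ i by rw [mem_inds]; omega
  obtain ⟨j, rfl⟩ : ∃ k, j = k + 1 := ⟨j - 1, by omega⟩
  clear hi hj
  induction j generalizing i with
  | zero =>
    obtain ⟨hi, -, -⟩ := exists_of_entry_eq_one h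
    exact (Finset.mem_Icc.1 hi).1
  | succ j ih =>
    obtain ⟨k, hk, hk1⟩ := exists_entry_above hM (Nat.succ_pos j) (Nat.lt_succ_self _) h
    have := ih hk1
    omega

open Classical in
/-- The indicator of a `1` in row `i` in one of the columns `j, j+1, …`. -/
noncomputable def rowInd (M : Matrix (Finset.Icc 1 p) (Finset.Icc 1 q) ℝ) (i j : ℕ) : ℝ :=
  if 1 ≤ j ∧ ∃ l, j ≤ l ∧ entry M i l = 1 then 1 else 0

open Classical in
/-- The indicator of a `1` in column `j` in one of the rows up to `i`. -/
noncomputable def colInd (M : Matrix (Finset.Icc 1 p) (Finset.Icc 1 q) ℝ) (i j : ℕ) : ℝ :=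
  if i ≤ p ∧ ∃ k, k ≤ i ∧ entry M k j = 1 then 1 else 0

theorem rowInd_sub (hM : M ∈ packingMatrices p q) (i j : ℕ) :
    rowInd M i (j + 1) - rowInd M i (j + 2) = entry M i (j + 1) := by
  unfold rowInd
  by_cases h1 : entry M i (j + 1) = 1
  · rw [if_pos ⟨by omega, j + 1, le_rfl, h1⟩, if_neg, h1, sub_zero]
    rintro ⟨-, l, hl, hl1⟩
    have := entry_unique hM h1 hl1
    omega
  · rw [(entry_eq_zero_or_one hM i (j + 1)).resolve_right h1, sub_eq_zero]
    congr 1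
    refine propext ⟨?_, ?_⟩
    · rintro ⟨-, l, hl, hl1⟩
      have : l ≠ j + 1 := fun h => h1 (h ▸ hl1)
      exact ⟨by omega, l, by omega, hl1⟩
    · rintro ⟨-, l, hl, hl1⟩
      exact ⟨by omega, l, by omega, hl1⟩

/-- `shift` and `upper` hold because a `1` has another strictly above it in every column to its
left; `lower` holds because `colInd` increases only in a row that has a `1` in that column. -/
theorem feasible_inds (hM : M ∈ packingMatrices p q) :
    Feasible p q (rowInd M) (colInd M) where
  -- The conditions `1 ≤ j` in `rowInd` and `i ≤ p` in `colInd` secure the zeros off `inds p q`.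
  z_off i j hij := by
    refine if_neg ?_
    rintro ⟨hj, l, hl, hl1⟩
    have := entry_mem_inds hM hl1
    rw [mem_inds] at this hij
    omega
  w_off i j hij := by
    refine if_neg ?_
    rintro ⟨hi, k, hk, hk1⟩
    have := entry_mem_inds hM hk1
    rw [mem_inds] at this hij
    omega
  mono i j hi := by
    unfold colInd
    by_cases h : i ≤ p ∧ ∃ k, k ≤ i ∧ entry M k (j + 1) = 1
    · obtain ⟨-, k, hk, hk1⟩ := id h
      rw [if_pos h, if_pos ⟨hi, k, by omega, hk1⟩]
    · rw [if_neg h]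
      split_ifs <;> norm_num
  shift i j hi := by
    unfold colInd
    by_cases h : i + 1 ≤ p ∧ ∃ k, k ≤ i + 1 ∧ entry M k (j + 2) = 1
    · obtain ⟨-, k, hk, hk1⟩ := id h
      obtain ⟨l, hl, hl1⟩ := exists_entry_above hM (Nat.succ_pos j) (Nat.lt_succ_self _) hk1
      rw [if_pos h, if_pos ⟨hi.le, l, by omega, hl1⟩]
    · rw [if_neg h]
      split_ifs <;> norm_num
  top := by
    unfold colInd
    split_ifs <;> norm_num
  lower i j hi := by
    rw [rowInd_sub hM]
    unfold colInd
    by_cases h : i ≤ p ∧ ∃ k, k ≤ i ∧ entry M k (j + 1) = 1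
    · obtain ⟨-, k, hk, hk1⟩ := id h
      rw [if_pos h, if_pos ⟨hi, k, by omega, hk1⟩]
      rcases entry_eq_zero_or_one hM (i + 1) (j + 1) with h | h <;> rw [h] <;> norm_num
    · rw [if_neg h]
      by_cases h' : i + 1 ≤ p ∧ ∃ k, k ≤ i + 1 ∧ entry M k (j + 1) = 1
      · obtain ⟨-, k, hk, hk1⟩ := id h'
        have hki : k = i + 1 := by
          by_contra hne
          exact h ⟨hi.le, k, by omega, hk1⟩
        rw [if_pos h', ← hki, hk1, sub_zero]
      · rw [if_neg h']
        rcases entry_eq_zero_or_one hM (i + 1) (j + 1) with h | h <;> rw [h] <;> norm_num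
  upper i j := by
    unfold rowInd colInd
    by_cases h : 1 ≤ j ∧ ∃ l, j ≤ l ∧ entry M i l = 1
    · obtain ⟨hj, l, hl, hl1⟩ := id h
      have hi := mem_inds.1 (entry_mem_inds hM hl1)
      rw [if_pos h, if_pos]
      refine ⟨hi.2.2.1, ?_⟩
      rcases hl.eq_or_lt with rfl | hjl
      · exact ⟨i, le_rfl, hl1⟩
      · obtain ⟨k, hk, hk1⟩ := exists_entry_above hM hj hjl hl1
        exact ⟨k, hk.le, hk1⟩
    · rw [if_neg h]
      split_ifs <;> norm_num

theorem ofFuns_inds_mem (hM : M ∈ packingMatrices p q) :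
    ofFuns p q (rowInd M) (colInd M) ∈ zeroOnePoints p q := by
  refine ⟨(feasible_inds hM).ofFuns_mem, fun a => ?_, fun a => ?_⟩ <;>
    simp only [ofFuns, rowInd, colInd] <;> split_ifs <;> simp

theorem recoverX_ofFuns_inds (hM : M ∈ packingMatrices p q) :
    recoverX p q (ofFuns p q (rowInd M) (colInd M)) = onInds p q M := by
  have hF := feasible_inds hM
  funext ⟨⟨i, j⟩, ha⟩
  obtain ⟨l, rfl⟩ : ∃ k, j = k + 1 := ⟨j - 1, by rw [mem_inds] at ha; omega⟩
  simp only [recoverX, LinearMap.pi_apply, LinearMap.sub_apply, zVar_ofFuns hF.z_off]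
  rw [rowInd_sub hM]
  exact entry_coe (M := M) ⟨i, _⟩ ⟨l + 1, _⟩

end

theorem val_eq_zero_or_one {p q : ℕ} {v : Space p q} (hv : v ∈ zeroOnePoints p q) :
    (∀ i j, zVar p q i j v = 0 ∨ zVar p q i j v = 1) ∧
      ∀ i j, wVar p q i j v = 0 ∨ wVar p q i j v = 1 := by
  constructor <;> intro i j <;> by_cases h : (i, j) ∈ inds p q
  · rw [zVar_apply, coord_of_mem h]; exact hv.2.1 _
  · rw [zVar_apply, coord_of_notMem h]; exact Or.inl rfl
  · rw [wVar_apply, coord_of_mem h]; exact hv.2.2 _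
  · rw [wVar_apply, coord_of_notMem h]; exact Or.inl rfl

theorem recoverX_image_zeroOnePoints (p q : ℕ) :
    recoverX p q '' zeroOnePoints p q = onInds p q '' packingMatrices p q := by
  refine Subset.antisymm ?_ ?_
  · rintro _ ⟨v, hv, rfl⟩
    exact ⟨_, (feasible_of_mem hv.1).packingMatrix (val_eq_zero_or_one hv).1
      (val_eq_zero_or_one hv).2, rfl⟩
  · rintro _ ⟨M, hM, rfl⟩
    exact ⟨_, ofFuns_inds_mem hM, recoverX_ofFuns_inds hM⟩

theorem completeX_image_zeroOnePoints {p q : ℕ} (hq : 1 ≤ q) (hqp : q ≤ p) :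
    completeX p q '' {v ∈ zeroOnePoints p q | wVar p q 1 1 v = 1} =
      onInds p q '' partitioningMatrices p q := by
  refine Subset.antisymm ?_ ?_
  · rintro _ ⟨v, ⟨hv, h11⟩, rfl⟩
    have hF := feasible_of_mem hv.1
    obtain ⟨hz, hw⟩ := val_eq_zero_or_one hv
    -- Raise the first column of `z` to `1`. This respects `upper`, since `w 1 1 = 1` and `mono`
    -- make the first column of `w` equal to `1`, and it only relaxes `lower`. At the new point `z i
    -- 1` equals `w 1 1`, so its differences are the entries given by `completeX`, and every row has
    -- a `1`.
    set z : ℕ → ℕ → ℝ := fun i j => if 1 ≤ i ∧ i ≤ p ∧ j = 1 then 1 else zVar p q i j v with hzdef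
    have hz01 : ∀ i j, z i j = 0 ∨ z i j = 1 := by
      intro i j
      simp only [hzdef]
      split_ifs
      · exact Or.inr rfl
      · exact hz i j
    have hz2 : ∀ i j, z i (j + 2) = zVar p q i (j + 2) v := fun i j => if_neg (by omega)
    have hz1 : ∀ i, 1 ≤ i → i ≤ p → z i 1 = 1 := fun i hi hip => if_pos ⟨hi, hip, rfl⟩
    have hzle : ∀ i j, zVar p q i j v ≤ z i j := by
      intro i j
      simp only [hzdef]
      split_ifs
      · exact (hF.upper i j).trans (hF.w_le_one i j)
      · exact le_rfl
    have hF' : Feasible p q z fun i j => wVar p q i j v :=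
      { hF with
        z_off := fun i j hij => by
          simp only [hzdef]
          rw [if_neg]
          · exact hF.z_off i j hij
          · rw [mem_inds] at hij
            omega
        lower := fun i j hi => by
          rw [hz2]
          linarith [hF.lower i j hi, hzle (i + 1) (j + 1)]
        upper := fun i j => by
          simp only [hzdef]
          split_ifs with hij
          · obtain ⟨hi, hip, rfl⟩ := hij
            rw [← h11]
            exact hF.w_mono hi hip 0
          · exact hF.upper i j }
    have hM := hF'.packingMatrix hz01 hw
    refine ⟨_, ⟨hM.1, fun i => ?_⟩, ?_⟩
    · have hi := Finset.mem_Icc.1 i.2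
      obtain ⟨j, hj, hj1⟩ := hF'.exists_entry_of_row hz01 (hz1 i.1 hi.1 hi.2)
      exact ⟨⟨j, hj⟩, hj1, fun j' hj' => hM.2 i _ _ hj' hj1⟩
    · funext ⟨⟨i, j⟩, ha⟩
      have hij := mem_inds.1 ha
      obtain ⟨l, rfl⟩ : ∃ k, j = k + 1 := ⟨j - 1, by omega⟩
      simp only [completeX, LinearMap.pi_apply, LinearMap.sub_apply, onInds]
      rw [hz2]
      by_cases hl : l = 0
      · subst hl
        rw [if_pos rfl, h11, hz1 i (by omega) hij.2.2.1]
      · rw [if_neg (by omega)]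
        simp only [hzdef]
        rw [if_neg (by omega)]
  · rintro _ ⟨M, hM', rfl⟩
    have hM := partitioningMatrices_subset p q hM'
    have hF := feasible_inds hM
    have hentry : ∀ i, 1 ≤ i → i ≤ p → ∃ j, entry M i j = 1 := by
      intro i hi hip
      obtain ⟨j, hj, -⟩ := hM'.2 ⟨i, Finset.mem_Icc.2 ⟨hi, hip⟩⟩
      exact ⟨j.1, (entry_coe ⟨i, _⟩ j).trans hj⟩
    have h11 : wVar p q 1 1 (ofFuns p q (rowInd M) (colInd M)) = 1 := by
      rw [wVar_ofFuns hF.w_off]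
      obtain ⟨j, hj⟩ := hentry 1 le_rfl (hq.trans hqp)
      have hj1 : j = 1 := by
        have := mem_inds.1 (entry_mem_inds hM hj)
        omega
      exact if_pos ⟨hq.trans hqp, 1, le_rfl, hj1 ▸ hj⟩
    refine ⟨_, ⟨ofFuns_inds_mem hM, h11⟩, ?_⟩
    -- Every row has a `1`, so `z i 1 = 1 = w 1 1` and the two projections agree at this point.
    rw [← recoverX_ofFuns_inds hM]
    funext ⟨⟨i, j⟩, ha⟩
    have hij := mem_inds.1 ha
    simp only [completeX, recoverX, LinearMap.pi_apply, LinearMap.sub_apply]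
    split_ifs with hj
    · subst hj
      obtain ⟨j, hj⟩ := hentry i (by omega) hij.2.2.1
      rw [h11]
      have hone : rowInd M i 1 = 1 := if_pos ⟨le_rfl, j, (mem_inds.1 (entry_mem_inds hM hj)).1, hj⟩
      rw [zVar_ofFuns hF.z_off i 1, hone]
    · rfl

/-! ### The orbitopes as projections -/

theorem onInds_image_convexHull {p q : ℕ} (S : Set (Matrix (Finset.Icc 1 p) (Finset.Icc 1 q) ℝ)) :
    onInds p q '' convexHull ℝ S = convexHull ℝ (onInds p q '' S) :=
  IsLinearMap.image_convexHull ⟨fun _ _ => rfl, fun _ _ => rfl⟩ S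

theorem recoverX_image_compactPoly (p q : ℕ) :
    recoverX p q '' compactPoly p q = packingOrbitope p q := by
  rw [compactPoly_eq_convexHull, LinearMap.image_convexHull, recoverX_image_zeroOnePoints,
    ← onInds_image_convexHull]
  rfl

theorem completeX_image_face {p q : ℕ} (hq : 1 ≤ q) (hqp : q ≤ p) :
    completeX p q '' {v ∈ compactPoly p q | wVar p q 1 1 v = 1} = partitioningOrbitope p q := by
  rw [compactPoly_face_eq_convexHull, LinearMap.image_convexHull,
    completeX_image_zeroOnePoints hq hqp, ← onInds_image_convexHull]
  rfl

theorem isExtendedFormulation_compactPoly (p q : ℕ) :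
    IsExtendedFormulation (compactPoly p q) (packingOrbitope p q) :=
  ⟨⟨_, zeroOnePoints_finite p q, compactPoly_eq_convexHull p q⟩, _,
    recoverX_image_compactPoly p q⟩

theorem isExtendedFormulation_face {p q : ℕ} (hq : 1 ≤ q) (hqp : q ≤ p) :
    IsExtendedFormulation {v ∈ compactPoly p q | wVar p q 1 1 v = 1}
      (partitioningOrbitope p q) :=
  ⟨⟨_, (zeroOnePoints_finite p q).subset (sep_subset _ _), compactPoly_face_eq_convexHull p q⟩, _,
    completeX_image_face hq hqp⟩

/-! ### The change of variables -/

/-- Indices outside `S` contribute `0`. Hence the sums below may mention missing positions or arcs,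
and boundary cases need no separate formulas. -/
theorem total_congr {α : Type} [DecidableEq α] {S N N' : Finset α}
    (h : ∀ a ∈ S, (a ∈ N ↔ a ∈ N')) (x : S → ℝ) : total N x = total N' x := by
  have key : ∀ M : Finset α, total M x = ∑ a ∈ M with a ∈ S, coord a x := by
    intro M
    rw [total_apply, Finset.sum_filter_of_ne]
    intro a _ hne
    by_contra ha
    exact hne (coord_of_notMem ha x)
  rw [key, key]
  refine Finset.sum_congr (Finset.ext fun a => ?_) fun _ _ => rfl
  simp only [Finset.mem_filter]
  exact and_congr_left (h a)

theorem mem_diagArcs {p q : ℕ} {e : Node × Node} :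
    e ∈ diagArcs p q ↔ ∃ i j, i < p ∧ j < min (i + 1) q ∧ e = dArc i j := by
  simp only [diagArcs, Finset.mem_image, Finset.mem_filter, Finset.mem_product, Finset.mem_range,
    Prod.exists]
  constructor
  · rintro ⟨i, j, ⟨⟨hi, hj⟩, h⟩, rfl⟩
    exact ⟨i, j, hi, h, rfl⟩
  · rintro ⟨i, j, hi, h, rfl⟩
    exact ⟨i, j, ⟨⟨hi, by omega⟩, h⟩, rfl⟩

theorem mem_vertArcs {p q : ℕ} {e : Node × Node} :
    e ∈ vertArcs p q ↔ ∃ i j, i < p ∧ j ≤ min i q ∧ e = vArc i j := by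
  simp only [vertArcs, Finset.mem_image, Finset.mem_filter, Finset.mem_product, Finset.mem_range,
    Prod.exists]
  constructor
  · rintro ⟨i, j, ⟨⟨hi, hj⟩, h⟩, rfl⟩
    exact ⟨i, j, hi, h, rfl⟩
  · rintro ⟨i, j, hi, h, rfl⟩
    exact ⟨i, j, ⟨⟨hi, by omega⟩, h⟩, rfl⟩

theorem mem_arcs {p q : ℕ} {e : Node × Node} :
    e ∈ arcs p q ↔ (∃ i j, i < p ∧ j ≤ min i q ∧ e = vArc i j) ∨
      (∃ i j, i < p ∧ j < min (i + 1) q ∧ e = dArc i j) ∨ e = (Node.s, Node.grid 0 0) ∨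
      ∃ j, j ≤ q ∧ e = (Node.grid p j, Node.t) := by
  simp only [arcs, Finset.mem_union, mem_vertArcs, mem_diagArcs, Finset.mem_singleton,
    Finset.mem_image, Finset.mem_range, Nat.lt_succ_iff, or_assoc, eq_comm (b := e)]

theorem dArc_mem_arcs {p q i j : ℕ} : dArc i j ∈ arcs p q ↔ i < p ∧ j < min (i + 1) q := by
  rw [mem_arcs]
  simp only [dArc, vArc, Prod.mk.injEq, Node.grid.injEq, reduceCtorEq]
  grind

theorem vArc_mem_arcs {p q i j : ℕ} : vArc i j ∈ arcs p q ↔ i < p ∧ j ≤ min i q := by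
  rw [mem_arcs]
  simp only [dArc, vArc, Prod.mk.injEq, Node.grid.injEq, reduceCtorEq]
  grind

theorem mem_vbar {p q i j k l : ℕ} :
    Node.grid k l ∈ vbar p q i j ↔ (k, l) ∈ inds p q ∧ l = j ∧ k ≤ i := by
  simp only [vbar, Finset.mem_image, Finset.mem_filter, Prod.exists, Node.grid.injEq]
  constructor
  · rintro ⟨k, l, h, rfl, rfl⟩
    exact h
  · exact fun h => ⟨k, l, h, rfl, rfl⟩

theorem mem_diagInArcs_vbar {p q i j : ℕ} {e : Node × Node} :
    e ∈ diagInArcs p q (vbar p q i j) ↔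
      ∃ k l, k < p ∧ l < min (k + 1) q ∧ l + 1 = j ∧ k + 1 ≤ i ∧ e = dArc k l := by
  rw [diagInArcs, Finset.mem_filter, mem_diagArcs]
  constructor
  · rintro ⟨⟨k, l, hk, hl, rfl⟩, h, -⟩
    obtain ⟨-, h1, h2⟩ := mem_vbar.1 h
    exact ⟨k, l, hk, hl, h1, h2, rfl⟩
  · rintro ⟨k, l, hk, hl, rfl, hki, rfl⟩
    refine ⟨⟨k, l, hk, hl, rfl⟩, mem_vbar.2 ⟨?_, rfl, hki⟩, fun h => ?_⟩
    · rw [mem_inds]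
      omega
    · have := (mem_vbar.1 h).2.1
      omega

theorem mem_bar {p q i j k l : ℕ} :
    (k, l) ∈ bar p q i j ↔ (k, l) ∈ inds p q ∧ k = i ∧ j ≤ l := by
  rw [bar, Finset.mem_filter]

section

variable {p q : ℕ} (x : inds p q → ℝ) (y : arcs p q → ℝ)

theorem total_bar (i j : ℕ) :
    total (bar p q i j) x = coord (i, j) x + total (bar p q i (j + 1)) x := by
  have hnot : (i, j) ∉ bar p q i (j + 1) := by
    rw [mem_bar]
    omega
  have hsplit : total (bar p q i j) x = total (insert (i, j) (bar p q i (j + 1))) x := by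
    refine total_congr ?_ x
    rintro ⟨k, l⟩ hkl
    simp only [Finset.mem_insert, mem_bar, Prod.mk.injEq, hkl, true_and]
    omega
  rw [hsplit, total_apply, Finset.sum_insert hnot, ← total_apply]

theorem total_diagInArcs (i j : ℕ) :
    total (diagInArcs p q (vbar p q (i + 1) (j + 1))) y =
      total (diagInArcs p q (vbar p q i (j + 1))) y + coord (dArc i j) y := by
  have hnot : dArc i j ∉ diagInArcs p q (vbar p q i (j + 1)) := by
    rw [mem_diagInArcs_vbar]
    rintro ⟨k, l, -, -, -, hk, he⟩
    simp only [dArc, Prod.mk.injEq, Node.grid.injEq] at he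
    omega
  have hsplit : total (diagInArcs p q (vbar p q (i + 1) (j + 1))) y =
      total (insert (dArc i j) (diagInArcs p q (vbar p q i (j + 1)))) y := by
    refine total_congr (fun e he => ?_) y
    rw [Finset.mem_insert, mem_diagInArcs_vbar, mem_diagInArcs_vbar]
    constructor
    · rintro ⟨k, l, hk, hl, hlj, hki, rfl⟩
      obtain rfl : l = j := by omega
      rcases hki.eq_or_lt with h | h
      · obtain rfl : k = i := by omega
        exact Or.inl rfl
      · exact Or.inr ⟨k, l, hk, hl, hlj, by omega, rfl⟩
    · rintro (rfl | ⟨k, l, hk, hl, hlj, hki, rfl⟩)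
      · rw [dArc_mem_arcs] at he
        exact ⟨i, j, he.1, he.2, rfl, le_rfl, rfl⟩
      · exact ⟨k, l, hk, hl, hlj, by omega, rfl⟩
  rw [hsplit, total_apply, Finset.sum_insert hnot, ← total_apply, add_comm]

/-- The bar from column `0` is a whole row although `(i,0)` is no index; hence the condition on `j`.
Likewise a row beyond `p` is excluded in the companion for columns. -/
theorem total_bar_of_notMem {i j : ℕ} (hj : 1 ≤ j) (h : (i, j) ∉ inds p q) :
    total (bar p q i j) x = 0 := by
  have : total (bar p q i j) x = total (∅ : Finset (ℕ × ℕ)) x := by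
    refine total_congr ?_ x
    rintro ⟨k, l⟩ hkl
    simp only [mem_bar, Finset.notMem_empty, iff_false]
    rw [mem_inds] at h hkl
    omega
  rw [this, total_apply, Finset.sum_empty]

theorem total_diagInArcs_of_notMem {i j : ℕ} (hi : i ≤ p) (h : (i, j) ∉ inds p q) :
    total (diagInArcs p q (vbar p q i j)) y = 0 := by
  have : total (diagInArcs p q (vbar p q i j)) y = total (∅ : Finset (Node × Node)) y := by
    refine total_congr (fun e he => ?_) y
    simp only [mem_diagInArcs_vbar, Finset.notMem_empty, iff_false]
    rintro ⟨k, l, hk, hl, hlj, hki, -⟩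
    rw [mem_inds] at h
    omega
  rw [this, total_apply, Finset.sum_empty]

theorem zVar_changeVars (i : ℕ) {j : ℕ} (hj : 1 ≤ j) :
    zVar p q i j (changeVars p q (x, y)) = total (bar p q i j) x := by
  by_cases h : (i, j) ∈ inds p q
  · rw [zVar_apply, coord_of_mem h]; rfl
  · rw [zVar_apply, coord_of_notMem h, total_bar_of_notMem x hj h]

theorem wVar_changeVars {i : ℕ} (hi : i ≤ p) (j : ℕ) :
    wVar p q i j (changeVars p q (x, y)) = total (diagInArcs p q (vbar p q i j)) y := by
  by_cases h : (i, j) ∈ inds p q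
  · rw [wVar_apply, coord_of_mem h]; rfl
  · rw [wVar_apply, coord_of_notMem h, total_diagInArcs_of_notMem y hi h]

theorem recoverX_changeVars : recoverX p q (changeVars p q (x, y)) = x := by
  funext ⟨⟨i, j⟩, ha⟩
  have hj := (mem_inds.1 ha).1
  simp only [recoverX, LinearMap.pi_apply, LinearMap.sub_apply]
  rw [zVar_changeVars x y i hj, zVar_changeVars x y i (by omega), total_bar, add_sub_cancel_right,
    coord_of_mem ha]

theorem coord_dArc_eq {i j : ℕ} (hi : i < p) :
    coord (dArc i j) y = wVar p q (i + 1) (j + 1) (changeVars p q (x, y)) -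
      wVar p q i (j + 1) (changeVars p q (x, y)) := by
  rw [wVar_changeVars x y hi, wVar_changeVars x y hi.le, total_diagInArcs, add_sub_cancel_left]

end

theorem ext_vars {p q : ℕ} {u v : Space p q}
    (hz : ∀ i j, (i, j) ∈ inds p q → zVar p q i j u = zVar p q i j v)
    (hw : ∀ i j, (i, j) ∈ inds p q → wVar p q i j u = wVar p q i j v) : u = v := by
  refine Prod.ext (funext fun a => ?_) (funext fun a => ?_)
  · have := hz a.1.1 a.1.2 a.2
    rwa [zVar_apply, zVar_apply, coord_of_mem a.2, coord_of_mem a.2] at this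
  · have := hw a.1.1 a.1.2 a.2
    rwa [wVar_apply, wVar_apply, coord_of_mem a.2, coord_of_mem a.2] at this

theorem changeVars_eq_iff {p q : ℕ} (x : inds p q → ℝ) (y : arcs p q → ℝ) (v : Space p q) :
    changeVars p q (x, y) = v ↔ x = recoverX p q v ∧
      ∀ i j, i < p → j < min (i + 1) q →
        coord (dArc i j) y = wVar p q (i + 1) (j + 1) v - wVar p q i (j + 1) v := by
  constructor
  · rintro rfl
    exact ⟨(recoverX_changeVars x y).symm, fun i j hi _ => coord_dArc_eq x y hi⟩
  · rintro ⟨hx, hy⟩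
    have hoffz : ∀ i j, (i, j) ∉ inds p q → zVar p q i j v = 0 := fun i j h => coord_of_notMem h _
    have hoffw : ∀ i j, (i, j) ∉ inds p q → wVar p q i j v = 0 := fun i j h => coord_of_notMem h _
    refine ext_vars (fun i j hij => ?_) (fun i j hij => ?_)
    -- Sum the differences from the right: `n` bounds the distance to column `q + 1`, where both
    -- sides vanish. The part for `w` sums downwards from row `0` instead.
    · have key : ∀ n j, 1 ≤ j → q + 1 ≤ j + n → total (bar p q i j) x = zVar p q i j v := by
        intro n
        induction n with
        | zero =>
          intro j hj hn
          have hoff : (i, j) ∉ inds p q := by rw [mem_inds]; omega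
          rw [total_bar_of_notMem x hj hoff, hoffz i j hoff]
        | succ n ih =>
          intro j hj hn
          by_cases h : (i, j) ∈ inds p q
          · rw [total_bar, ih (j + 1) (by omega) (by omega), coord_of_mem h, hx]
            simp [recoverX]
          · rw [total_bar_of_notMem x hj h, hoffz i j h]
      have hj := (mem_inds.1 hij).1
      rw [zVar_changeVars x y i hj, key (q + 1) j hj (by omega)]
    · have key : ∀ i j, i ≤ p → total (diagInArcs p q (vbar p q i j)) y = wVar p q i j v := by
        intro i
        induction i with
        | zero =>
          intro j hi
          have hoff : (0, j) ∉ inds p q := by rw [mem_inds]; omega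
          rw [total_diagInArcs_of_notMem y hi hoff, hoffw 0 j hoff]
        | succ i ih =>
          intro j hi
          by_cases h : (i + 1, j) ∈ inds p q
          · have h' := mem_inds.1 h
            obtain ⟨j, rfl⟩ : ∃ k, j = k + 1 := ⟨j - 1, by omega⟩
            rw [total_diagInArcs, ih (j + 1) (by omega), hy i j (by omega) (by omega),
              add_sub_cancel]
          · rw [total_diagInArcs_of_notMem y hi h, hoffw _ _ h]
      have hi := (mem_inds.1 hij).2.2.1
      rw [wVar_changeVars x y hi, key i j hi]

/-! ### Flows -/

section

variable {p q : ℕ} (y : arcs p q → ℝ)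

theorem total_pair {α : Type} [DecidableEq α] {S : Finset α} {a b : α} (h : a ≠ b)
    (x : S → ℝ) : total {a, b} x = coord a x + coord b x := by
  rw [total_apply, Finset.sum_pair h]

theorem total_singleton {α : Type} [DecidableEq α] {S : Finset α} (a : α)
    (x : S → ℝ) : total {a} x = coord a x := by
  rw [total_apply, Finset.sum_singleton]

theorem vArc_ne_dArc (i j k l : ℕ) (_ : j = l + 1 ∨ j = l) : vArc i j ≠ dArc k l := by
  simp only [vArc, dArc, ne_eq, Prod.mk.injEq, Node.grid.injEq]
  omega

theorem total_inArcs_succ_succ (i j : ℕ) :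
    total (inArcs p q {Node.grid (i + 1) (j + 1)}) y =
      coord (vArc i (j + 1)) y + coord (dArc i j) y := by
  rw [← total_pair (vArc_ne_dArc _ _ _ _ (Or.inl rfl))]
  refine total_congr (fun e he => ?_) y
  simp only [inArcs, Finset.mem_filter, he, true_and, Finset.mem_insert, Finset.mem_singleton]
  rcases mem_arcs.1 he with ⟨k, l, hk, hl, rfl⟩ | ⟨k, l, hk, hl, rfl⟩ | rfl | ⟨l, hl, rfl⟩ <;>
    simp only [vArc, dArc, Prod.mk.injEq, Node.grid.injEq, reduceCtorEq] <;> grind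

theorem total_inArcs_succ_zero (i : ℕ) :
    total (inArcs p q {Node.grid (i + 1) 0}) y = coord (vArc i 0) y := by
  rw [← total_singleton]
  refine total_congr (fun e he => ?_) y
  simp only [inArcs, Finset.mem_filter, he, true_and, Finset.mem_singleton]
  rcases mem_arcs.1 he with ⟨k, l, hk, hl, rfl⟩ | ⟨k, l, hk, hl, rfl⟩ | rfl | ⟨l, hl, rfl⟩ <;>
    simp only [vArc, dArc, Prod.mk.injEq, Node.grid.injEq, reduceCtorEq] <;> grind

theorem total_inArcs_zero_zero :
    total (inArcs p q {Node.grid 0 0}) y = coord (Node.s, Node.grid 0 0) y := by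
  rw [← total_singleton]
  refine total_congr (fun e he => ?_) y
  simp only [inArcs, Finset.mem_filter, he, true_and, Finset.mem_singleton]
  rcases mem_arcs.1 he with ⟨k, l, hk, hl, rfl⟩ | ⟨k, l, hk, hl, rfl⟩ | rfl | ⟨l, hl, rfl⟩ <;>
    simp [vArc, dArc, Prod.mk.injEq, Node.grid.injEq, reduceCtorEq]

theorem total_outArcs_of_lt {i : ℕ} (hi : i < p) (j : ℕ) :
    total (outArcs p q {Node.grid i j}) y = coord (vArc i j) y + coord (dArc i j) y := by
  rw [← total_pair (vArc_ne_dArc _ _ _ _ (Or.inr rfl))]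
  refine total_congr (fun e he => ?_) y
  simp only [outArcs, Finset.mem_filter, he, true_and, Finset.mem_insert, Finset.mem_singleton]
  rcases mem_arcs.1 he with ⟨k, l, hk, hl, rfl⟩ | ⟨k, l, hk, hl, rfl⟩ | rfl | ⟨l, hl, rfl⟩ <;>
    simp only [vArc, dArc, Prod.mk.injEq, Node.grid.injEq, reduceCtorEq] <;> grind

theorem total_outArcs_last (j : ℕ) :
    total (outArcs p q {Node.grid p j}) y = coord (Node.grid p j, Node.t) y := by
  rw [← total_singleton]
  refine total_congr (fun e he => ?_) y
  simp only [outArcs, Finset.mem_filter, he, true_and, Finset.mem_singleton]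
  rcases mem_arcs.1 he with ⟨k, l, hk, hl, rfl⟩ | ⟨k, l, hk, hl, rfl⟩ | rfl | ⟨l, hl, rfl⟩ <;>
    simp only [vArc, dArc, Prod.mk.injEq, Node.grid.injEq, reduceCtorEq] <;> grind

theorem total_outArcs_s :
    total (outArcs p q {Node.s}) y = coord (Node.s, Node.grid 0 0) y := by
  rw [← total_singleton]
  refine total_congr (fun e he => ?_) y
  simp only [outArcs, Finset.mem_filter, he, true_and, Finset.mem_singleton]
  rcases mem_arcs.1 he with ⟨k, l, hk, hl, rfl⟩ | ⟨k, l, hk, hl, rfl⟩ | rfl | ⟨l, hl, rfl⟩ <;>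
    simp [vArc, dArc]

theorem total_inArcs_s : total (inArcs p q {Node.s}) y = 0 := by
  have : total (inArcs p q {Node.s}) y = total (∅ : Finset (Node × Node)) y := by
    refine total_congr (fun e he => ?_) y
    simp only [inArcs, Finset.mem_filter, he, true_and, Finset.mem_singleton]
    rcases mem_arcs.1 he with ⟨k, l, hk, hl, rfl⟩ | ⟨k, l, hk, hl, rfl⟩ | rfl | ⟨l, hl, rfl⟩ <;>
      simp [vArc, dArc]
  rw [this, total_apply, Finset.sum_empty]

end

theorem grid_mem_nodes {p q i j : ℕ} :
    Node.grid i j ∈ nodes p q ↔ (i, j) ∈ inds p q ∨ (i ≤ p ∧ j = 0) := by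
  simp only [nodes, Finset.mem_union, Finset.mem_image, Finset.mem_range, Finset.mem_insert,
    Finset.mem_singleton, Node.grid.injEq, reduceCtorEq, Prod.exists, or_false]
  refine or_congr ⟨?_, ?_⟩ ⟨?_, ?_⟩
  · rintro ⟨k, l, h, rfl, rfl⟩
    exact h
  · exact fun h => ⟨i, j, h, rfl, rfl⟩
  · rintro ⟨k, h, rfl, rfl⟩
    exact ⟨by omega, rfl⟩
  · rintro ⟨h, rfl⟩
    exact ⟨i, by omega, rfl, rfl⟩

/-- The amount of flow entering column `j` down to row `i`, as a function of the `w i j`; the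
whole flow enters column `0`. -/
noncomputable def entering (w : ℕ → ℕ → ℝ) (i j : ℕ) : ℝ := if j = 0 then 1 else w i j

/-- The value on an arc of the flow determined by the `w i j`. -/
noncomputable def arcFlow (p : ℕ) (w : ℕ → ℕ → ℝ) : Node × Node → ℝ
  | (Node.grid i j, Node.grid _ j') =>
    if j' = j then entering w i j - w (i + 1) (j + 1) else w (i + 1) (j + 1) - w i (j + 1)
  | (Node.grid _ j, Node.t) => entering w p j - w p (j + 1)
  | _ => 1

theorem arcFlow_vArc (p : ℕ) (w : ℕ → ℕ → ℝ) (i j : ℕ) :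
    arcFlow p w (vArc i j) = entering w i j - w (i + 1) (j + 1) := if_pos rfl

theorem arcFlow_dArc (p : ℕ) (w : ℕ → ℕ → ℝ) (i j : ℕ) :
    arcFlow p w (dArc i j) = w (i + 1) (j + 1) - w i (j + 1) := if_neg (by omega)

theorem arcFlow_mem_flows {p q : ℕ} {z w : ℕ → ℕ → ℝ} (h : Feasible p q z w) :
    (fun e => arcFlow p w e.1) ∈ flows p q := by
  set y : arcs p q → ℝ := fun e => arcFlow p w e.1 with hy
  have hv : ∀ i j, i < p → coord (vArc i j) y = entering w i j - w (i + 1) (j + 1) := by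
    intro i j hi
    by_cases hij : vArc i j ∈ arcs p q
    · rw [coord_of_mem hij, ← arcFlow_vArc p]
    · rw [coord_of_notMem hij]
      rw [vArc_mem_arcs] at hij
      rw [entering, if_neg (by omega), h.w_off, h.w_off, sub_zero] <;> rw [mem_inds] <;> omega
  have hd : ∀ i j, i < p → coord (dArc i j) y = w (i + 1) (j + 1) - w i (j + 1) := by
    intro i j hi
    by_cases hij : dArc i j ∈ arcs p q
    · rw [coord_of_mem hij, ← arcFlow_dArc p]
    · rw [coord_of_notMem hij]
      rw [dArc_mem_arcs] at hij
      rw [h.w_off, h.w_off, sub_zero] <;> rw [mem_inds] <;> omega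
  have hs : coord (Node.s, Node.grid 0 0) y = 1 :=
    coord_of_mem (mem_arcs.2 (Or.inr (Or.inr (Or.inl rfl)))) y
  have ht : ∀ j ≤ q, coord (Node.grid p j, Node.t) y = entering w p j - w p (j + 1) := fun j hj =>
    coord_of_mem (mem_arcs.2 (Or.inr (Or.inr (Or.inr ⟨j, hj, rfl⟩)))) y
  -- The flow through `(i,j)` is what has entered column `j` down to row `i`, less what has moved on
  -- to column `j + 1` by then.
  have hout : ∀ i j, i ≤ p → j ≤ q →
      total (outArcs p q {Node.grid i j}) y = entering w i j - w i (j + 1) := by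
    intro i j hi hj
    rcases hi.eq_or_lt with rfl | hi
    · rw [total_outArcs_last, ht j hj]
    · rw [total_outArcs_of_lt y hi, hv i j hi, hd i j hi]
      ring
  refine ⟨?_, ?_, ?_⟩
  · rintro ⟨e, he⟩
    change 0 ≤ arcFlow p w e
    rcases mem_arcs.1 he with ⟨k, l, hk, hl, rfl⟩ | ⟨k, l, hk, hl, rfl⟩ | rfl | ⟨l, hl, rfl⟩
    · rw [arcFlow_vArc, sub_nonneg]
      cases l with
      | zero => exact h.w_le_one _ _
      | succ l => exact h.shift k l hk
    · rw [arcFlow_dArc, sub_nonneg]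
      exact h.mono k l hk
    · exact zero_le_one
    · refine sub_nonneg.2 ?_
      cases l with
      | zero => exact h.w_le_one _ _
      | succ l => exact h.w_anti p l
  · intro e he hes het
    cases e with
    | s => exact absurd rfl hes
    | t => exact absurd rfl het
    | grid i j =>
      rw [grid_mem_nodes, mem_inds] at he
      rw [hout i j (by omega) (by omega)]
      cases i with
      | zero =>
        obtain rfl : j = 0 := by omega
        rw [total_inArcs_zero_zero, hs, h.w_off 0 _ (by rw [mem_inds]; omega), sub_zero]
        rfl
      | succ i =>
        cases j with
        | zero =>
          rw [total_inArcs_succ_zero, hv i 0 (by omega)]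
          rfl
        | succ j =>
          rw [total_inArcs_succ_succ, hv i _ (by omega), hd i _ (by omega)]
          simp only [entering, Nat.add_eq_zero_iff, one_ne_zero, and_false, if_false]
          ring
  · rw [total_outArcs_s, total_inArcs_s, hs, sub_zero]

/-- A flow of value one is determined by its diagonal arcs. -/
theorem eq_arcFlow {p q : ℕ} (hqp : q ≤ p) {y : arcs p q → ℝ} (hy : y ∈ flows p q) (x : inds p q → ℝ) :
    y = fun e => arcFlow p (fun i j => wVar p q i j (changeVars p q (x, y))) e.1 := by
  set w : ℕ → ℕ → ℝ := fun i j => wVar p q i j (changeVars p q (x, y)) with hw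
  have hoff : ∀ i j, (i, j) ∉ inds p q → w i j = 0 := fun i j h => coord_of_notMem h _
  have hd : ∀ i j, i < p → coord (dArc i j) y = w (i + 1) (j + 1) - w i (j + 1) :=
    fun i j hi => coord_dArc_eq x y hi
  have hs : coord (Node.s, Node.grid 0 0) y = 1 := by
    have := hy.2.2
    rwa [total_outArcs_s, total_inArcs_s, sub_zero] at this
  have hcons : ∀ i j, (i, j) ∈ inds p q ∨ (i ≤ p ∧ j = 0) →
      total (inArcs p q {Node.grid i j}) y = total (outArcs p q {Node.grid i j}) y :=
    fun i j h => hy.2.1 _ (grid_mem_nodes.2 h) (by simp) (by simp)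
  have hin : ∀ i j, i ≤ p → (∀ k < i, coord (vArc k j) y = entering w k j - w (k + 1) (j + 1)) →
      (i = 0 → j = 0) →
      total (inArcs p q {Node.grid i j}) y = entering w i j - w i (j + 1) := by
    intro i j hi hv hj
    cases i with
    | zero =>
      rw [hj rfl, total_inArcs_zero_zero, hs, hoff 0 _ (by rw [mem_inds]; omega), sub_zero]
      rfl
    | succ i =>
      cases j with
      | zero =>
        rw [total_inArcs_succ_zero, hv i (by omega)]
        rfl
      | succ j =>
        rw [total_inArcs_succ_succ, hv i (by omega), hd i _ (by omega)]
        simp only [entering, Nat.add_eq_zero_iff, one_ne_zero, and_false, if_false]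
        ring
  -- Induction down the rows: conservation at `(i,j)` determines the outgoing vertical arc from the
  -- incoming arcs and the outgoing diagonal one.
  have hv : ∀ i j, i < p → coord (vArc i j) y = entering w i j - w (i + 1) (j + 1) := by
    intro i j
    induction i using Nat.strong_induction_on with
    | h i ih =>
      intro hi
      by_cases hij : (i, j) ∈ inds p q ∨ (i ≤ p ∧ j = 0)
      · have h1 := hcons i j hij
        have h2 := hin i j hi.le (fun k hk => ih k hk (hk.trans hi)) (by
          rw [mem_inds] at hij
          omega)
        rw [total_outArcs_of_lt y hi, hd i j hi] at h1
        linarith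
      · rw [mem_inds] at hij
        have hnot : vArc i j ∉ arcs p q := by
          rw [vArc_mem_arcs]
          omega
        rw [coord_of_notMem hnot, entering, if_neg (by omega), hoff, hoff, sub_zero] <;>
          rw [mem_inds] <;> omega
  funext ⟨e, he⟩
  rw [← coord_of_mem he y]
  change coord e y = arcFlow p w e
  rcases mem_arcs.1 he with ⟨k, l, hk, hl, rfl⟩ | ⟨k, l, hk, hl, rfl⟩ | rfl | ⟨l, hl, rfl⟩
  · rw [hv k l hk, arcFlow_vArc]
  · rw [hd k l hk, arcFlow_dArc]
  · exact hs
  -- Because `q ≤ p`, each `(p,l)` with `l ≤ q` is a node, and conservation there gives the arc into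
  -- `t`.
  · have hl' : (p, l) ∈ inds p q ∨ (p ≤ p ∧ l = 0) := by
      rw [mem_inds]
      omega
    have h1 := hcons p l hl'
    rw [total_outArcs_last, hin p l le_rfl (fun k hk => hv k l hk) (by omega)] at h1
    exact h1.symm

/-- `diag` and `vert` are nonnegativity of diagonal and vertical arcs, `top` is that of the last
vertical arc of column `0`, `lower` and `upper` are the two couplings, and `nonneg` concerns a sum
of arc values. -/
theorem changeVars_mem_compactPoly {p q : ℕ} (hq : 1 ≤ q) (hqp : q ≤ p)
    {v : (inds p q → ℝ) × (arcs p q → ℝ)} (hv : v ∈ extPoly p q) :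
    changeVars p q v ∈ compactPoly p q := by
  obtain ⟨x, y⟩ := v
  obtain ⟨hy, hdx, hbar⟩ := hv
  set v := changeVars p q (x, y) with hv
  have hy0 : ∀ e, 0 ≤ coord e y := by
    intro e
    by_cases he : e ∈ arcs p q
    · rw [coord_of_mem he]; exact hy.1 _
    · rw [coord_of_notMem he]
  have hvert : ∀ i j, vArc i j ∈ arcs p q →
      coord (vArc i j) y = entering (fun i j => wVar p q i j v) i j - wVar p q (i + 1) (j + 1) v := by
    intro i j hij
    rw [coord_of_mem hij]
    exact (congrFun (eq_arcFlow hqp hy x) ⟨vArc i j, hij⟩).trans (arcFlow_vArc _ _ _ _)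
  intro c
  cases c with
  | diag i j hi hj =>
    have := hy0 (dArc i j)
    rw [coord_dArc_eq x y hi] at this
    simpa [Constraint.lhs, Constraint.rhs] using this
  | vert i j hij hi =>
    have h := mem_inds.1 hij
    have := hy0 (vArc i j)
    rw [hvert i j (vArc_mem_arcs.2 ⟨hi, by omega⟩), entering, if_neg (by omega)] at this
    simpa [Constraint.lhs, Constraint.rhs] using this
  | top =>
    have := hy0 (vArc (p - 1) 0)
    rw [hvert _ _ (vArc_mem_arcs.2 ⟨by omega, by omega⟩), entering, if_pos rfl,
      Nat.sub_add_cancel (hq.trans hqp)] at this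
    simpa [Constraint.lhs, Constraint.rhs] using this
  | lower i j hij =>
    have h := mem_inds.1 hij
    obtain ⟨j, rfl⟩ : ∃ k, j = k + 1 := ⟨j - 1, by omega⟩
    obtain ⟨i, rfl⟩ : ∃ k, i = k + 1 := ⟨i - 1, by omega⟩
    have h1 := hdx _ _ hij
    have h2 := total_bar x (i + 1) (j + 1)
    simp only [Nat.add_sub_cancel] at h1
    rw [coord_dArc_eq x y (by omega)] at h1
    rw [← zVar_changeVars x y (i + 1) (by omega), ← zVar_changeVars x y (i + 1) (by omega)] at h2
    simp only [Constraint.lhs, Constraint.rhs, LinearMap.add_apply, LinearMap.sub_apply,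
      Nat.add_sub_cancel, hv]
    linarith
  | upper i j hij =>
    have h := mem_inds.1 hij
    have h1 := hbar i j hij
    rw [← zVar_changeVars x y i h.1, ← wVar_changeVars x y h.2.2.1] at h1
    simpa [Constraint.lhs, Constraint.rhs] using h1
  | nonneg i hi hip =>
    have h1 : 0 ≤ wVar p q i (min i q) v := by
      rw [wVar_changeVars x y hip, total_apply]
      exact Finset.sum_nonneg fun e _ => hy0 e
    simpa [Constraint.lhs, Constraint.rhs] using h1

/-- Injectivity: `x` is recovered by differences and `y` by `eq_arcFlow`. Surjectivity: `arcFlow`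
builds a flow from `w`. -/
theorem bijOn_changeVars {p q : ℕ} (hq : 1 ≤ q) (hqp : q ≤ p) :
    BijOn (changeVars p q) (extPoly p q) (compactPoly p q) := by
  refine ⟨fun v hv => changeVars_mem_compactPoly hq hqp hv, ?_, ?_⟩
  · rintro ⟨x, y⟩ hv ⟨x', y'⟩ hv' h
    refine Prod.ext ?_ ?_
    · exact (recoverX_changeVars x y).symm.trans (h ▸ recoverX_changeVars x' y')
    · refine (eq_arcFlow hqp hv.1 x).trans ?_
      rw [h]
      exact (eq_arcFlow hqp hv'.1 x').symm
  · intro v hv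
    have h := feasible_of_mem hv
    set y : arcs p q → ℝ := fun e => arcFlow p (fun i j => wVar p q i j v) e.1 with hy
    have himage : changeVars p q (recoverX p q v, y) = v := by
      refine (changeVars_eq_iff _ _ _).2 ⟨rfl, fun i j hi hj => ?_⟩
      rw [coord_of_mem (dArc_mem_arcs.2 ⟨hi, hj⟩)]
      exact arcFlow_dArc _ _ _ _
    refine ⟨(recoverX p q v, y), ⟨arcFlow_mem_flows h, fun i j hij => ?_, fun i j hij => ?_⟩,
      himage⟩
    · have hij' := mem_inds.1 hij
      obtain ⟨j, rfl⟩ : ∃ k, j = k + 1 := ⟨j - 1, by omega⟩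
      obtain ⟨i, rfl⟩ : ∃ k, i = k + 1 := ⟨i - 1, by omega⟩
      simp only [Nat.add_sub_cancel]
      rw [coord_dArc_eq (recoverX p q v) y (by omega), himage, coord_of_mem hij]
      exact h.lower i j (by omega)
    · have hij' := mem_inds.1 hij
      have h1 := h.upper i j
      rw [← himage, zVar_changeVars _ _ i hij'.1, wVar_changeVars _ _ hij'.2.2.1] at h1
      exact h1

/-! ### The size of the compact system -/

theorem card_inds_le (p q : ℕ) : (inds p q).card ≤ p * q :=
  (Finset.card_filter_le _ _).trans (by simp)

theorem card_inds_lt {p q : ℕ} (hq : 2 ≤ q) (hqp : q ≤ p) : (inds p q).card < p * q := by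
  have hcard : (Finset.Icc 1 p ×ˢ Finset.Icc 1 q).card = p * q := by simp
  rw [← hcard]
  -- The position `(1,2)` lies above the diagonal.
  refine Finset.card_lt_card (Finset.filter_ssubset.2 ⟨(1, 2), ?_, ?_⟩)
  · simp only [Finset.mem_product, Finset.mem_Icc]
    omega
  · simp

theorem card_var (p q : ℕ) : Fintype.card (Var p q) = 2 * (inds p q).card := by
  rw [Fintype.card_sum, Fintype.card_coe, two_mul]

/-- An injective encoding of the constraints; the constraint `w p 1 ≤ 1` takes the place that is
missing in the second family. -/
def Constraint.code {p q : ℕ} : Constraint p q → ℕ × ℕ × ℕ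
  | .diag i j _ _ => (0, i + 1, j + 1)
  | .vert i j _ _ => (1, i, j)
  | .top => (1, p, 1)
  | .lower i j _ => (2, i, j)
  | .upper i j _ => (3, i, j)
  | .nonneg i _ _ => (4, i, 0)

theorem Constraint.code_injective {p q : ℕ} :
    Function.Injective (Constraint.code : Constraint p q → ℕ × ℕ × ℕ) := by
  intro c c' h
  cases c <;> cases c' <;>
    simp only [Constraint.code, Prod.mk.injEq, Nat.add_right_cancel_iff] at h <;>
    first
    | rfl
    | (exfalso; omega)
    | (obtain ⟨-, rfl, rfl⟩ := h; rfl)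
    | (obtain ⟨-, rfl, -⟩ := h; rfl)

theorem Constraint.code_mem {p q : ℕ} (hq : 1 ≤ q) (hqp : q ≤ p) {c : Constraint p q}
    (hc : ¬ c.InNonnegFamily) : c.code ∈ Finset.range 4 ×ˢ inds p q := by
  cases c with
  | nonneg => exact absurd trivial hc
  | diag i j hi hj =>
    simp only [Constraint.code, Finset.mem_product, Finset.mem_range, mem_inds]
    omega
  | top =>
    simp only [Constraint.code, Finset.mem_product, Finset.mem_range, mem_inds]
    omega
  | vert i j h hi => simpa [Constraint.code] using h
  | lower i j h => simpa [Constraint.code] using h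
  | upper i j h => simpa [Constraint.code] using h

theorem neg_wVar_eq {p q i j : ℕ} (h : (i, j) ∈ inds p q) :
    ∃ k : Var p q, -wVar p q i j = -Var.val k := by
  refine ⟨Sum.inr ⟨(i, j), h⟩, congrArg _ ?_⟩
  ext v
  · rw [wVar, coord, dif_pos h]; rfl
  · rw [wVar, coord, dif_pos h]; rfl

theorem Constraint.isNonnegativity_of_inNonnegFamily {p q : ℕ} (hq : 1 ≤ q)
    {c : Constraint p q} (hc : c.InNonnegFamily) : c.IsNonnegativity := by
  cases c with
  | nonneg i hi hip => exact ⟨neg_wVar_eq (by rw [mem_inds]; omega), rfl⟩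
  | _ => exact hc.elim

/-- As `(0,1)` is no index, this constraint reads `w 1 1 ≥ 0`. Leaving it out makes the count strict
even for `q = 1`. -/
theorem Constraint.isNonnegativity_diag_zero {p q : ℕ} (hp : 0 < p) (hq : 0 < min (0 + 1) q) :
    (Constraint.diag 0 0 hp hq : Constraint p q).IsNonnegativity := by
  refine ⟨?_, rfl⟩
  obtain ⟨k, hk⟩ := neg_wVar_eq (p := p) (q := q) (i := 1) (j := 1) (by rw [mem_inds]; omega)
  refine ⟨k, ?_⟩
  rw [← hk]
  have h0 : wVar p q 0 (0 + 1) = 0 := by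
    rw [wVar, coord, dif_neg (by rw [mem_inds]; omega), LinearMap.zero_comp]
  simp only [Constraint.lhs]
  rw [h0, zero_sub]

theorem encard_le_of_injOn {α β : Type} {s : Set α} {f : α → β} {t : Finset β}
    (hf : InjOn f s) (hst : MapsTo f s t) : s.encard ≤ (t.card : ℕ∞) := by
  rw [← hf.encard_image, ← Set.encard_coe_eq_coe_finsetCard]
  exact encard_le_encard hst.image_subset

theorem encard_not_inNonnegFamily {p q : ℕ} (hq : 2 ≤ q) (hqp : q ≤ p) :
    {c : Constraint p q | ¬ c.InNonnegFamily}.encard < ((4 * p * q : ℕ) : ℕ∞) := by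
  refine (encard_le_of_injOn Constraint.code_injective.injOn
    fun c hc => Constraint.code_mem (one_le_two.trans hq) hqp hc).trans_lt ?_
  rw [Finset.card_product, Finset.card_range, Nat.cast_lt, mul_assoc]
  have := card_inds_lt hq hqp
  omega

theorem encard_not_isNonnegativity {p q : ℕ} (hq : 1 ≤ q) (hqp : q ≤ p) :
    {c : Constraint p q | ¬ c.IsNonnegativity}.encard < ((4 * p * q : ℕ) : ℕ∞) := by
  have hmem : ((0, 1, 1) : ℕ × ℕ × ℕ) ∈ Finset.range 4 ×ˢ inds p q := by
    simp only [Finset.mem_product, Finset.mem_range, mem_inds]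
    omega
  refine (encard_le_of_injOn (t := (Finset.range 4 ×ˢ inds p q).erase (0, 1, 1))
    Constraint.code_injective.injOn fun c hc => ?_).trans_lt ?_
  · refine Finset.mem_coe.2 (Finset.mem_erase.2 ⟨fun h => hc ?_, Constraint.code_mem hq hqp
      fun h => hc (Constraint.isNonnegativity_of_inNonnegFamily hq h)⟩)
    have h0 : c = Constraint.diag 0 0 (by omega) (by omega) := Constraint.code_injective h
    rw [h0]
    exact Constraint.isNonnegativity_diag_zero _ _
  · rw [Nat.cast_lt]
    refine (Finset.card_erase_lt_of_mem hmem).trans_le ?_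
    rw [Finset.card_product, Finset.card_range, mul_assoc]
    exact Nat.mul_le_mul_left 4 (card_inds_le p q)

/-- An injective encoding of the variables. -/
def Var.code {p q : ℕ} : Var p q → ℕ × ℕ × ℕ
  | Sum.inl a => (0, a.1)
  | Sum.inr a => (1, a.1)

theorem Var.code_injective {p q : ℕ} : Function.Injective (Var.code : Var p q → ℕ × ℕ × ℕ) := by
  rintro (a | a) (b | b) h <;> simp only [Var.code, Prod.mk.injEq] at h
  · exact congrArg _ (Subtype.ext h.2)
  · omega
  · omega
  · exact congrArg _ (Subtype.ext h.2)

theorem coord_single {α : Type} [DecidableEq α] {S : Finset α} (a : α) (b : S) :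
    coord a (Pi.single b 1 : S → ℝ) = if b.1 = a then 1 else 0 := by
  by_cases h : a ∈ S
  · rw [coord_of_mem h, Pi.single_apply]
    refine if_congr ?_ rfl rfl
    rw [Subtype.ext_iff, eq_comm]
  · rw [coord_of_notMem h, if_neg]
    rintro rfl
    exact h b.2

theorem zVar_unit {p q : ℕ} (i j : ℕ) (k : Var p q) :
    zVar p q i j (Var.unit k) = if k.code = (0, i, j) then 1 else 0 := by
  rcases k with a | a
  · simp [zVar_apply, Var.unit, Var.code, coord_single]
  · simp [zVar_apply, Var.unit, Var.code]

theorem wVar_unit {p q : ℕ} (i j : ℕ) (k : Var p q) :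
    wVar p q i j (Var.unit k) = if k.code = (1, i, j) then 1 else 0 := by
  rcases k with a | a
  · simp [wVar_apply, Var.unit, Var.code]
  · simp [wVar_apply, Var.unit, Var.code, coord_single]

/-- The possible positions of nonzero coefficients: the codes of a constraint and a variable. -/
def coeffPosition : ℕ × ℕ × ℕ → (ℕ × ℕ × ℕ) × (ℕ × ℕ × ℕ)
  | (0, i, j) => ((0, i, j), (1, i - 1, j))
  | (1, i, j) => ((0, i, j), (1, i, j))
  | (2, i, j) => ((1, i, j), (1, i, j))
  | (3, i, j) => ((1, i, j), (1, i + 1, j + 1))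
  | (4, i, j) => ((2, i, j), (1, i, j))
  | (5, i, j) => ((2, i, j), (1, i - 1, j))
  | (6, i, j) => ((2, i, j), (0, i, j))
  | (7, i, j) => ((2, i, j), (0, i, j + 1))
  | (8, i, j) => ((3, i, j), (0, i, j))
  | (_, i, j) => ((3, i, j), (1, i, j))

/-- Slots `0`–`1` serve `diag`, `2`–`3` serve `vert` and `top`, `4`–`7` serve `lower`, `8`–`9` serve
`upper`. The constraint `top`, with code `(1, p, 1)`, has a single coefficient, so slot `(3, p, 1)`
stays empty; this yields the strict bound. -/
theorem exists_coeffPosition {p q : ℕ} (hq : 1 ≤ q) (hqp : q ≤ p) {c : Constraint p q}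
    {k : Var p q} (hc : ¬ c.InNonnegFamily) (hk : c.coeff k ≠ 0) :
    ∃ n ∈ (Finset.range 10 ×ˢ inds p q).erase (3, p, 1), coeffPosition n = (c.code, k.code) := by
  have hmem : ∀ {m i j : ℕ}, m < 10 → (i, j) ∈ inds p q → (m = 3 → i < p) →
      (m, i, j) ∈ (Finset.range 10 ×ˢ inds p q).erase (3, p, 1) := by
    intro m i j hm hij h3
    simp only [Finset.mem_erase, Finset.mem_product, Finset.mem_range, hm, hij, and_self,
      and_true, ne_eq, Prod.mk.injEq]
    omega
  have hone : ∀ {a b : ℝ}, a - b ≠ 0 → a ≠ 0 ∨ b ≠ 0 := by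
    intro a b hab
    by_contra! h
    exact hab (by rw [h.1, h.2, sub_zero])
  cases c with
  | nonneg => exact absurd trivial hc
  | diag i j hi hj =>
    have hij : (i + 1, j + 1) ∈ inds p q := by
      rw [mem_inds]
      omega
    simp only [Constraint.coeff, Constraint.lhs, LinearMap.sub_apply, wVar_unit] at hk
    rcases hone hk with h | h
    · refine ⟨(0, i + 1, j + 1), hmem (by norm_num) hij (by omega), ?_⟩
      rw [ne_eq, ite_eq_right_iff, Classical.not_imp] at h
      rw [h.1]; rfl
    · refine ⟨(1, i + 1, j + 1), hmem (by norm_num) hij (by omega), ?_⟩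
      rw [ne_eq, ite_eq_right_iff, Classical.not_imp] at h
      rw [h.1]; rfl
  | vert i j hij hi =>
    simp only [Constraint.coeff, Constraint.lhs, LinearMap.sub_apply, wVar_unit] at hk
    rcases hone hk with h | h
    · refine ⟨(3, i, j), hmem (by norm_num) hij (by omega), ?_⟩
      rw [ne_eq, ite_eq_right_iff, Classical.not_imp] at h
      rw [h.1]; rfl
    · refine ⟨(2, i, j), hmem (by norm_num) hij (by omega), ?_⟩
      rw [ne_eq, ite_eq_right_iff, Classical.not_imp] at h
      rw [h.1]; rfl
  | top =>
    have hij : (p, 1) ∈ inds p q := by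
      rw [mem_inds]
      omega
    simp only [Constraint.coeff, Constraint.lhs, wVar_unit] at hk
    refine ⟨(2, p, 1), hmem (by norm_num) hij (by omega), ?_⟩
    rw [ne_eq, ite_eq_right_iff, Classical.not_imp] at hk
    rw [hk.1]; rfl
  | lower i j hij =>
    simp only [Constraint.coeff, Constraint.lhs, LinearMap.sub_apply, LinearMap.add_apply,
      wVar_unit, zVar_unit] at hk
    by_cases h1 : k.code = (1, i, j)
    · exact ⟨(4, i, j), hmem (by norm_num) hij (by omega), by rw [h1]; rfl⟩
    by_cases h2 : k.code = (1, i - 1, j)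
    · exact ⟨(5, i, j), hmem (by norm_num) hij (by omega), by rw [h2]; rfl⟩
    by_cases h3 : k.code = (0, i, j)
    · exact ⟨(6, i, j), hmem (by norm_num) hij (by omega), by rw [h3]; rfl⟩
    by_cases h4 : k.code = (0, i, j + 1)
    · exact ⟨(7, i, j), hmem (by norm_num) hij (by omega), by rw [h4]; rfl⟩
    simp [h1, h2, h3, h4] at hk
  | upper i j hij =>
    simp only [Constraint.coeff, Constraint.lhs, LinearMap.sub_apply, wVar_unit, zVar_unit] at hk
    rcases hone hk with h | h
    · refine ⟨(8, i, j), hmem (by norm_num) hij (by omega), ?_⟩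
      rw [ne_eq, ite_eq_right_iff, Classical.not_imp] at h
      rw [h.1]; rfl
    · refine ⟨(9, i, j), hmem (by norm_num) hij (by omega), ?_⟩
      rw [ne_eq, ite_eq_right_iff, Classical.not_imp] at h
      rw [h.1]; rfl

theorem encard_coeff_ne_zero {p q : ℕ} (hq : 1 ≤ q) (hqp : q ≤ p) :
    {ck : Constraint p q × Var p q | ¬ ck.1.InNonnegFamily ∧ ck.1.coeff ck.2 ≠ 0}.encard <
      ((10 * p * q : ℕ) : ℕ∞) := by
  have hmem : ((3, p, 1) : ℕ × ℕ × ℕ) ∈ Finset.range 10 ×ˢ inds p q := by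
    simp only [Finset.mem_product, Finset.mem_range, mem_inds]
    omega
  refine (encard_le_of_injOn (f := Prod.map Constraint.code Var.code)
    (t := ((Finset.range 10 ×ˢ inds p q).erase (3, p, 1)).image coeffPosition)
    (Constraint.code_injective.prodMap Var.code_injective).injOn fun ck h => ?_).trans_lt ?_
  · exact Finset.mem_coe.2 (Finset.mem_image.2 (exists_coeffPosition hq hqp h.1 h.2))
  · rw [Nat.cast_lt]
    refine (Finset.card_image_le.trans_lt (Finset.card_erase_lt_of_mem hmem)).trans_le ?_
    rw [Finset.card_product, Finset.card_range, mul_assoc]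
    exact Nat.mul_le_mul_left 10 (card_inds_le p q)

end Orbitope

theorem theorem3p6 (p q : ℕ) (hq : 1 ≤ q) (hqp : q ≤ p) :
    -- on `x` and the diagonal arc variables, the change of variables is invertible,
    -- with the stated inverse
    (∀ (x : inds p q → ℝ) (y : arcs p q → ℝ) (v : Space p q),
      changeVars p q (x, y) = v ↔
        x = recoverX p q v ∧
        ∀ i j, i < p → j < min (i + 1) q →
          coord (dArc i j) y = wVar p q (i + 1) (j + 1) v - wVar p q i (j + 1) v) ∧
    -- it maps the one polytope bijectively onto the other
    Set.BijOn (changeVars p q) (extPoly p q) (compactPoly p q) ∧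
    -- the number of variables
    Fintype.card (Var p q) ≤ 2 * p * q ∧
    (2 ≤ q → Fintype.card (Var p q) < 2 * p * q) ∧
    -- the number of constraints, apart from nonnegativity constraints
    {c : Constraint p q | ¬ c.IsNonnegativity}.encard < ((4 * p * q : ℕ) : ℕ∞) ∧
    (2 ≤ q → {c : Constraint p q | ¬ c.InNonnegFamily}.encard < ((4 * p * q : ℕ) : ℕ∞)) ∧
    -- the number of nonzero coefficients
    {ck : Constraint p q × Var p q | ¬ ck.1.InNonnegFamily ∧ ck.1.coeff ck.2 ≠ 0}.encard <
      ((10 * p * q : ℕ) : ℕ∞) ∧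
    -- the packing orbitope
    IsExtendedFormulation (compactPoly p q) (packingOrbitope p q) ∧
    recoverX p q '' compactPoly p q = packingOrbitope p q ∧
    -- the partitioning orbitope
    (∀ v ∈ compactPoly p q, wVar p q 1 1 v ≤ 1) ∧
    IsExtendedFormulation {v ∈ compactPoly p q | wVar p q 1 1 v = 1}
      (partitioningOrbitope p q) ∧
    completeX p q '' {v ∈ compactPoly p q | wVar p q 1 1 v = 1} =
      partitioningOrbitope p q := by
  refine ⟨changeVars_eq_iff, bijOn_changeVars hq hqp, ?_, fun hq2 => ?_,
    encard_not_isNonnegativity hq hqp, fun hq2 => encard_not_inNonnegFamily hq2 hqp,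
    encard_coeff_ne_zero hq hqp, isExtendedFormulation_compactPoly p q,
    recoverX_image_compactPoly p q, fun v hv => (feasible_of_mem hv).w_le_one 1 1,
    isExtendedFormulation_face hq hqp, completeX_image_face hq hqp⟩
  · rw [card_var, mul_assoc]
    exact Nat.mul_le_mul_left 2 (card_inds_le p q)
  · rw [card_var, mul_assoc]
    have := card_inds_lt hq2 hqp
    omega
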